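/- **Theorem 2.6.** Let $k,l\ge 3$ and let $n$ be a natural number. A *map* on the two-sphere is a finite connected graph, with at least one edge, cellularly embedded in $S^2$ (described combinatorially by the finite set of its oriented edges, the fixed-point-free involution reversing them, and the permutation sending an oriented edge to the next one along the face on its left, with Euler characteristic $2$); loops and multiple edges are allowed. A *generalised football pattern of type $(k,l,n)$* is a map on $S^2$ with its faces painted black and white such that * at least three edges meet at every vertex (a loop counting twice); * all black faces are $k$-gons and all white faces are $l$-gons; * the edges of each black face meet only edges of white faces; * going around any white face, precisely every $n$-th edge meets an edge of a black face, and all other edges meet edges of white faces. If $S^2$ carries a generalised football pattern of type $(k,l,n)$, then $l\le 10$ and $n\le 6$. Moreover, for $k,l\ge 3$, such a pattern exists if and only if $(k,l,n)$ is one of the $16$ (pairwise different) sporadic triples $$(3,3,1),(3,4,1),(4,3,1),(3,5,1),(5,3,1),\ (3,6,2),(3,8,2),(4,6,2),(3,10,2),(5,6,2),$$ $$(3,6,3),(4,6,3),(5,6,3),\ (3,6,6),(4,6,6),(5,6,6),$$ all of which have $k\le 5$, or belongs to one of the $4$ infinite sequences $$(k,4,2),\quad (k,3,3),\quad (k,4,4),\quad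 (k,5,5)\qquad (k\ge 3);$$ no sporadic triple belongs to an infinite sequence. For every triple that occurs, the following table (with $m=l/n$) gives a minimal realisation, that is, a generalised football pattern of type $(k,mn,n)$ with $b$ black and $w$ white faces such that every generalised football pattern of the same type has at least $b$ black and at least $w$ white faces. | | $k$ | $m$ | $n$ | minimal realisation | $b$ | $w$ | |---|---|---|---|---|---|---| | 1 | 3 | 3 | 1 | octahedron | 4 | 4 | | 2 | 3 | 4 | 1 | cuboctahedron | 8 | 6 | | 3 | 4 | 3 | 1 | cuboctahedron | 6 | 8 | | 4 | 3 | 5 | 1 | icosidodecahedron | 20 | 12 | | 5 | 5 | 3 | 1 | icosidodecahedron | 12 | 20 | | 6 | 3 | 3 | 2 | truncated tetrahedron | 4 | 4 | | 7 | 3 | 4 | 2 | truncated cube | 8 | 6 | | 8 | 4 | 3 | 2 | truncated octahedron | 6 | 8 | | 9 | 3 | 5 | 2 | truncated dodecahedron | 20 | 12 | | 10 | 5 | 3 | 2 | truncated icosahedron (the football) | 12 | 20 | | 11 | $k\ge 3$ | 2 | 2 | truncated American football | 2 | $k$ | | 12 | 3 | 2 | 3 | variation on the tetrahedron | 4 |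 6 | | 13 | 4 | 2 | 3 | variation on the cube | 6 | 12 | | 14 | 5 | 2 | 3 | variation on the dodecahedron | 12 | 30 | | 15 | $k\ge 3$ | 1 | 3 | partially truncated American football | 1 | $k$ | | 16 | $k\ge 3$ | 1 | 4 | double tin can | 2 | $2k$ | | 17 | $k\ge 3$ | 1 | 5 | zigzag tin can | 2 | $2k$ | | 18 | 3 | 1 | 6 | subdivision of the tetrahedron | 4 | 12 | | 19 | 4 | 1 | 6 | subdivision of the cube | 6 | 24 | | 20 | 5 | 1 | 6 | subdivision of the dodecahedron | 12 | 60 | Here the polyhedra in rows 1–5 are the rectified tetrahedron, octahedron, cube, icosahedron and dodecahedron respectively (the corners of the new faces are the midpoints of the old edges), with the faces coming from old faces black and those coming from old vertices white. In a truncated map all vertices are cut off; the new faces at the vertices are black. The *American football* is the sphere divided by $k$ meridians running from pole to pole; it is *partially truncated* if only one pole is cut off (again with the new face black). The *variation* on a map has in each face a smaller black copy of this face, whose corners are joined radially to the corners of the face, after which the old edges are erased. The *double tin can* is the $k$-prism with its two $k$-gons black and with $k$ additional edges along the equator, bisecting its lateral faces. The *zigzag tin can* consists of two rings, each a black $k$-gon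 surrounded by $k$ white pentagons (pentagons at adjacent sides of the $k$-gon sharing a side), glued along a zigzag curve. The *subdivision* of a map divides each of its edges by two new vertices into three parts, and divides each $k$-gonal face into a smaller black $k$-gon and $k$ white hexagons around it: with the boundary of the face oriented with the face on its left, each corner of the smaller $k$-gon is joined to the first of the two new vertices on the corresponding edge. -/

import Mathlib

/-- A map on a closed oriented surface, given combinatorially: `D` is the set of darts (oriented
edges), `edge` reverses a dart, and `face` sends a dart to the next dart along the boundary of the
face on its left.  The faces, edges and vertices of the map are the cycles of `face`, of `edge` and
of `vertex = face ∘ edge` (all darts with the same origin). -/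
structure CombMap (D : Type) where
  face : Equiv.Perm D
  edge : Equiv.Perm D
  edge_edge : ∀ d, edge (edge d) = d
  edge_ne : ∀ d, edge d ≠ d

namespace CombMap

variable {D : Type} (M : CombMap D)

/-- The permutation that turns a dart around its origin (clockwise) to the next one. -/
def vertex : Equiv.Perm D := M.face * M.edge

/-- The faces. -/
def Face : Type := Quotient (Equiv.Perm.SameCycle.setoid M.face)

/-- The (unoriented) edges. -/
def Edge : Type := Quotient (Equiv.Perm.SameCycle.setoid M.edge)

/-- The vertices. -/
def Vertex : Type := Quotient (Equiv.Perm.SameCycle.setoid M.vertex)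

/-- The face to the left of a dart. -/
def faceOf (d : D) : M.Face := Quotient.mk (Equiv.Perm.SameCycle.setoid M.face) d

/-- A map on the two-sphere: finite, connected, of Euler characteristic two. -/
structure IsSpherical : Prop where
  finite : Finite D
  connected : MulAction.IsPretransitive (Subgroup.closure {M.face, M.edge}) D
  euler : (Nat.card M.Vertex : ℤ) - Nat.card M.Edge + Nat.card M.Face = 2

/-- The dual map: the dart `d` becomes the dart crossing it that has the origin of `d` on its
left. -/
def dual : CombMap D where
  face := M.vertex⁻¹
  edge := M.edge
  edge_edge := M.edge_edge
  edge_ne := M.edge_ne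

end CombMap

/-- A map whose faces are painted black and white; `black` is the set of the darts that have a
black face on their left. -/
structure PaintedMap (D : Type) extends CombMap D where
  black : Set D
  black_face : ∀ d, face d ∈ black ↔ d ∈ black

namespace PaintedMap

variable {D : Type} (P : PaintedMap D)

/-- The number of black faces. -/
noncomputable def numBlack : ℕ := (P.toCombMap.faceOf '' P.black).ncard

/-- The number of white faces. -/
noncomputable def numWhite : ℕ := (P.toCombMap.faceOf '' P.blackᶜ).ncard

/-- Generalised football patterns of type `(k, l, n)`: the black faces are the `k`-gons and the
white faces are the `l`-gons (the painting is needed to tell them apart when `k = l`). -/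
structure IsFootballPattern (k l n : ℕ) : Prop where
  spherical : P.toCombMap.IsSpherical
  /-- At least three edges meet at every vertex. -/
  valence : ∀ d, 3 ≤ Function.minimalPeriod P.toCombMap.vertex d
  black_gon : ∀ d, d ∈ P.black → Function.minimalPeriod P.face d = k
  white_gon : ∀ d, d ∉ P.black → Function.minimalPeriod P.face d = l
  /-- The edges of black faces meet only edges of white faces. -/
  black_meets : ∀ d, d ∈ P.black → P.edge d ∉ P.black
  /-- Going around a white face, precisely every `n`-th edge meets an edge of a black face. -/
  white_meets : ∀ d, d ∉ P.black →
    ∃ r : ℕ, ∀ i : ℕ, P.edge (P.face^[i] d) ∈ P.black ↔ i ≡ r [MOD n]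

/-- `P` is a minimal realisation of the triple `(k, l, n)`: it is a generalised football pattern of
this type, with `b` black and `w` white faces, and no pattern of this type has fewer black faces
or fewer white faces. -/
structure IsMinimalRealisation (k l n b w : ℕ) : Prop where
  pattern : P.IsFootballPattern k l n
  numBlack_eq : P.numBlack = b
  numWhite_eq : P.numWhite = w
  minimal : ∀ (D' : Type) (Q : PaintedMap D'), Q.IsFootballPattern k l n →
    b ≤ Q.numBlack ∧ w ≤ Q.numWhite

end PaintedMap

/-- The two-sphere carries a generalised football pattern of type `(k, l, n)`. -/
def Realised (k l n : ℕ) : Prop :=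
  ∃ (D : Type) (P : PaintedMap D), P.IsFootballPattern k l n

/-! ### The Platonic solids

The rotation group `G` of a Platonic solid permutes its darts simply transitively.  Identify `G`
with the set of darts by means of one chosen dart; if `x` is the rotation by one step about the face
to the left of that dart and `y` is the half-turn about its midpoint, then `face` and `edge` are the
right multiplications by `x` and by `y`. -/

/-- The map with rotation group `G`, generated by the rotation `x` about a face and the half-turn
`y` about an edge. -/
def rotationMap {G : Type} [Group G] (x y : G) (hy : y * y = 1) (hy' : y ≠ 1) : CombMap G where
  face := Equiv.mulRight x
  edge := Equiv.mulRight y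
  edge_edge d := by simp [mul_assoc, hy]
  edge_ne d := by simpa using hy'

/-- The tetrahedron: `x` and `y * x` have order three. -/
def tetrahedron : CombMap (alternatingGroup (Fin 4)) :=
  rotationMap
    ⟨Equiv.swap 0 1 * Equiv.swap 1 2, Equiv.Perm.mem_alternatingGroup.mpr (by decide)⟩
    ⟨Equiv.swap 0 1 * Equiv.swap 2 3, Equiv.Perm.mem_alternatingGroup.mpr (by decide)⟩ (by decide) (by decide)

/-- The cube: `x` has order four and `y * x` has order three. -/
def cube : CombMap (Equiv.Perm (Fin 4)) :=
  rotationMap (finRotate 4) (Equiv.swap 0 1) (by decide) (by decide)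

/-- The dodecahedron: `x` has order five and `y * x` has order three. -/
def dodecahedron : CombMap (alternatingGroup (Fin 5)) :=
  rotationMap
    ⟨finRotate 5, Equiv.Perm.mem_alternatingGroup.mpr (by decide)⟩
    ⟨Equiv.swap 0 1 * Equiv.swap 2 3, Equiv.Perm.mem_alternatingGroup.mpr (by decide)⟩ (by decide) (by decide)

/-- The octahedron. -/
def octahedron : CombMap (Equiv.Perm (Fin 4)) := cube.dual

/-- The icosahedron. -/
def icosahedron : CombMap (alternatingGroup (Fin 5)) := dodecahedron.dual

/-! ### Constructions -/

/-- The darts of a rectified map.  Its edges correspond to the corners of the old faces, and a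
corner is given by the dart `d` that starts there; `inner` is the dart that has the shrunken old
face on its left, `outer` is its reverse. -/
inductive RectKind
  | inner
  | outer

/-- Rectification: every face is replaced by the polygon whose corners are the midpoints of its
edges.  The faces coming from old faces are painted black, those coming from old vertices white.
The rectified tetrahedron is the octahedron, the rectified cube or octahedron is the cuboctahedron,
and the rectified dodecahedron or icosahedron is the icosidodecahedron. -/
def CombMap.rectify {D : Type} (M : CombMap D) : PaintedMap (D × RectKind) where
  face :=
    { toFun := fun p => match p with
        | (d, .inner) => (M.face d, .inner)
        | (d, .outer) => (M.vertex.symm d, .outer)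
      invFun := fun p => match p with
        | (d, .inner) => (M.face.symm d, .inner)
        | (d, .outer) => (M.vertex d, .outer)
      left_inv := by rintro ⟨d, _ | _⟩ <;> simp
      right_inv := by rintro ⟨d, _ | _⟩ <;> simp }
  edge := Function.Involutive.toPerm
    (fun p => match p with
      | (d, .inner) => (d, .outer)
      | (d, .outer) => (d, .inner))
    (by rintro ⟨d, _ | _⟩ <;> rfl)
  edge_edge := by rintro ⟨d, _ | _⟩ <;> rfl
  edge_ne := by rintro ⟨d, _ | _⟩ <;> simp [Function.Involutive.toPerm]
  black := {p | p.2 = .inner}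
  black_face := by rintro ⟨d, _ | _⟩ <;> simp

/-- The darts of a truncated map: `side` is the middle part of the old dart `d`, and `cut` cuts off
the corner, at the origin of `d`, of the old face to the left of `d`; `rim` is the reverse of
`cut`. -/
inductive TruncKind
  | cut
  | side
  | rim

/-- Truncation: all vertices are cut off.  The new polygons at the old vertices are painted black,
the remainders of the old faces white. -/
def CombMap.truncate {D : Type} (M : CombMap D) : PaintedMap (D × TruncKind) where
  face :=
    { toFun := fun p => match p with
        | (d, .cut) => (d, .side)
        | (d, .side) => (M.face d, .cut)
        | (d, .rim) => (M.vertex.symm d, .rim)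
      invFun := fun p => match p with
        | (d, .side) => (d, .cut)
        | (d, .cut) => (M.face.symm d, .side)
        | (d, .rim) => (M.vertex d, .rim)
      left_inv := by rintro ⟨d, _ | _ | _⟩ <;> simp
      right_inv := by rintro ⟨d, _ | _ | _⟩ <;> simp }
  edge := Function.Involutive.toPerm
    (fun p => match p with
      | (d, .cut) => (d, .rim)
      | (d, .rim) => (d, .cut)
      | (d, .side) => (M.edge d, .side))
    (by rintro ⟨d, _ | _ | _⟩ <;> simp [M.edge_edge])
  edge_edge := by rintro ⟨d, _ | _ | _⟩ <;> simp [Function.Involutive.toPerm, M.edge_edge]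
  edge_ne := by rintro ⟨d, _ | _ | _⟩ <;> simp [Function.Involutive.toPerm, M.edge_ne]
  black := {p | p.2 = .rim}
  black_face := by rintro ⟨d, _ | _ | _⟩ <;> simp

/-- The darts of the variation of a map.  In each old face there is a smaller copy of it: `rim` is
the copy of the old dart `d` and `base` its reverse; `out` leads from the copy of the origin of `d`
to the origin of `d`, and `inn` is its reverse. -/
inductive VarKind
  | rim
  | base
  | out
  | inn

/-- The variation on a map: every face receives a smaller copy of itself in its interior (painted
black), whose corners are joined radially to the corners of the face, and then the old edges are
erased.  The white faces are hexagons, one for each old edge. -/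
def CombMap.variation {D : Type} (M : CombMap D) : PaintedMap (D × VarKind) where
  face :=
    { toFun := fun p => match p with
        | (d, .rim) => (M.face d, .rim)
        | (d, .base) => (d, .out)
        | (d, .out) => (M.vertex d, .inn)
        | (d, .inn) => (M.face.symm d, .base)
      invFun := fun p => match p with
        | (d, .rim) => (M.face.symm d, .rim)
        | (d, .out) => (d, .base)
        | (d, .inn) => (M.vertex.symm d, .out)
        | (d, .base) => (M.face d, .inn)
      left_inv := by rintro ⟨d, _ | _ | _ | _⟩ <;> simp
      right_inv := by rintro ⟨d, _ | _ | _ | _⟩ <;> simp }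
  edge := Function.Involutive.toPerm
    (fun p => match p with
      | (d, .rim) => (d, .base)
      | (d, .base) => (d, .rim)
      | (d, .out) => (d, .inn)
      | (d, .inn) => (d, .out))
    (by rintro ⟨d, _ | _ | _ | _⟩ <;> rfl)
  edge_edge := by rintro ⟨d, _ | _ | _ | _⟩ <;> rfl
  edge_ne := by rintro ⟨d, _ | _ | _ | _⟩ <;> simp [Function.Involutive.toPerm]
  black := {p | p.2 = .rim}
  black_face := by rintro ⟨d, _ | _ | _ | _⟩ <;> simp

/-- The darts of the subdivision of a map.  In each old face there is a smaller copy of it: `rim` is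
the copy of the old dart `d` and `base` its reverse.  The old dart is divided by two new vertices
into its parts `first`, `middle` and `last`; `out` leads from the copy of the origin of `d` to the
end of the first part of `d`, and `inn` is its reverse. -/
inductive SubdivKind
  | rim
  | base
  | out
  | inn
  | first
  | middle
  | last

/-- The subdivision of a map: every face is divided into a smaller copy of itself (painted black)
and a ring of white hexagons, one for each of its edges. -/
def CombMap.subdivision {D : Type} (M : CombMap D) : PaintedMap (D × SubdivKind) where
  face :=
    { toFun := fun p => match p with
        | (d, .rim) => (M.face d, .rim)
        | (d, .base) => (d, .out)
        | (d, .out) => (d, .middle)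
        | (d, .middle) => (d, .last)
        | (d, .last) => (M.face d, .first)
        | (d, .first) => (d, .inn)
        | (d, .inn) => (M.face.symm d, .base)
      invFun := fun p => match p with
        | (d, .rim) => (M.face.symm d, .rim)
        | (d, .out) => (d, .base)
        | (d, .middle) => (d, .out)
        | (d, .last) => (d, .middle)
        | (d, .first) => (M.face.symm d, .last)
        | (d, .inn) => (d, .first)
        | (d, .base) => (M.face d, .inn)
      left_inv := by rintro ⟨d, _ | _ | _ | _ | _ | _ | _⟩ <;> simp
      right_inv := by rintro ⟨d, _ | _ | _ | _ | _ | _ | _⟩ <;> simp }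
  edge := Function.Involutive.toPerm
    (fun p => match p with
      | (d, .rim) => (d, .base)
      | (d, .base) => (d, .rim)
      | (d, .out) => (d, .inn)
      | (d, .inn) => (d, .out)
      | (d, .middle) => (M.edge d, .middle)
      | (d, .first) => (M.edge d, .last)
      | (d, .last) => (M.edge d, .first))
    (by rintro ⟨d, _ | _ | _ | _ | _ | _ | _⟩ <;> simp [M.edge_edge])
  edge_edge := by
    rintro ⟨d, _ | _ | _ | _ | _ | _ | _⟩ <;> simp [Function.Involutive.toPerm, M.edge_edge]
  edge_ne := by
    rintro ⟨d, _ | _ | _ | _ | _ | _ | _⟩ <;> simp [Function.Involutive.toPerm, M.edge_ne]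
  black := {p | p.2 = .rim}
  black_face := by rintro ⟨d, _ | _ | _ | _ | _ | _ | _⟩ <;> simp

/-! ### The infinite sequences

Darts along `k` meridians, or along the sides of a `k`-gon, are indexed by `ZMod k`. -/

/-- The American football: `k` meridians from the north pole to the south pole.  The dart
`(i, true)` runs along the `i`-th meridian from the north pole to the south pole, `(i, false)` is
its reverse. -/
def americanFootball (k : ℕ) : CombMap (ZMod k × Bool) where
  face :=
    { toFun := fun p => match p with
        | (i, true) => (i + 1, false)
        | (i, false) => (i - 1, true)
      invFun := fun p => match p with
        | (i, true) => (i + 1, false)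
        | (i, false) => (i - 1, true)
      left_inv := by rintro ⟨i, _ | _⟩ <;> simp
      right_inv := by rintro ⟨i, _ | _⟩ <;> simp }
  edge := Function.Involutive.toPerm (fun p => (p.1, !p.2)) (by rintro ⟨i, _ | _⟩ <;> rfl)
  edge_edge := by rintro ⟨i, _ | _⟩ <;> rfl
  edge_ne := by rintro ⟨i, _ | _⟩ <;> simp [Function.Involutive.toPerm]

/-- The darts of the partially truncated American football: cutting off the north pole produces a
`k`-gon, with sides `rim` and their reverses `base`; `out` runs along what is left of the meridian
from the start of the `i`-th side of the `k`-gon to the south pole, `inn` is its reverse. -/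
inductive PartKind
  | rim
  | base
  | out
  | inn

/-- The American football truncated at the north pole only.  The polygon at the north pole is
painted black, the `k` triangles that remain of the old faces are painted white. -/
def partiallyTruncatedAmericanFootball (k : ℕ) : PaintedMap (ZMod k × PartKind) where
  face :=
    { toFun := fun p => match p with
        | (i, .rim) => (i + 1, .rim)
        | (i, .base) => (i, .out)
        | (i, .out) => (i + 1, .inn)
        | (i, .inn) => (i - 1, .base)
      invFun := fun p => match p with
        | (i, .rim) => (i - 1, .rim)
        | (i, .out) => (i, .base)
        | (i, .inn) => (i - 1, .out)
        | (i, .base) => (i + 1, .inn)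
      left_inv := by rintro ⟨i, _ | _ | _ | _⟩ <;> simp
      right_inv := by rintro ⟨i, _ | _ | _ | _⟩ <;> simp }
  edge := Function.Involutive.toPerm
    (fun p => match p with
      | (i, .rim) => (i, .base)
      | (i, .base) => (i, .rim)
      | (i, .out) => (i, .inn)
      | (i, .inn) => (i, .out))
    (by rintro ⟨i, _ | _ | _ | _⟩ <;> rfl)
  edge_edge := by rintro ⟨i, _ | _ | _ | _⟩ <;> rfl
  edge_ne := by rintro ⟨i, _ | _ | _ | _⟩ <;> simp [Function.Involutive.toPerm]
  black := {p | p.2 = .rim}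
  black_face := by rintro ⟨i, _ | _ | _ | _⟩ <;> simp

/-- The darts of one half of the double tin can: a `k`-gon with sides `rim` and their reverses
`base`, the dart `out` from the start of the `i`-th side to the equator, its reverse `inn`, and the
`i`-th dart `equator` along the equator. -/
inductive TinKind
  | rim
  | base
  | out
  | inn
  | equator

/-- The double tin can: the `k`-prism with `k` additional edges along the equator.  The two halves
(each seen from its own pole, and indexed by a Boolean) are glued along the equator.  The two
`k`-gons are painted black, the `2 * k` quadrilaterals white. -/
def doubleTinCan (k : ℕ) : PaintedMap ((ZMod k × Bool) × TinKind) where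
  face :=
    { toFun := fun p => match p with
        | ((i, s), .rim) => ((i + 1, s), .rim)
        | ((i, s), .base) => ((i, s), .out)
        | ((i, s), .out) => ((i, s), .equator)
        | ((i, s), .equator) => ((i + 1, s), .inn)
        | ((i, s), .inn) => ((i - 1, s), .base)
      invFun := fun p => match p with
        | ((i, s), .rim) => ((i - 1, s), .rim)
        | ((i, s), .out) => ((i, s), .base)
        | ((i, s), .equator) => ((i, s), .out)
        | ((i, s), .inn) => ((i - 1, s), .equator)
        | ((i, s), .base) => ((i + 1, s), .inn)
      left_inv := by rintro ⟨⟨i, s⟩, _ | _ | _ | _ | _⟩ <;> simp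
      right_inv := by rintro ⟨⟨i, s⟩, _ | _ | _ | _ | _⟩ <;> simp }
  edge := Function.Involutive.toPerm
    (fun p => match p with
      | ((i, s), .rim) => ((i, s), .base)
      | ((i, s), .base) => ((i, s), .rim)
      | ((i, s), .out) => ((i, s), .inn)
      | ((i, s), .inn) => ((i, s), .out)
      | ((i, s), .equator) => ((-i, !s), .equator))
    (by rintro ⟨⟨i, s⟩, _ | _ | _ | _ | _⟩ <;> simp)
  edge_edge := by
    rintro ⟨⟨i, s⟩, _ | _ | _ | _ | _⟩ <;> simp [Function.Involutive.toPerm]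
  edge_ne := by
    rintro ⟨⟨i, s⟩, _ | _ | _ | _ | _⟩ <;> simp [Function.Involutive.toPerm]
  black := {p | p.2 = .rim}
  black_face := by rintro ⟨⟨i, s⟩, _ | _ | _ | _ | _⟩ <;> simp

/-- The darts of one half of the zigzag tin can: a `k`-gon with sides `rim` and their reverses
`base`, the dart `out` from the start of the `i`-th side to the zigzag curve, its reverse `inn`, and
the two darts `zig` and `zag` of the `i`-th pentagon along the zigzag curve. -/
inductive ZigzagKind
  | rim
  | base
  | out
  | inn
  | zig
  | zag

/-- The zigzag tin can: two rings, each made up of a `k`-gon (painted black) and `k` pentagons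
(painted white) around it, glued along a zigzag curve.  The two halves (each seen from its own pole)
are indexed by a Boolean. -/
def zigzagTinCan (k : ℕ) : PaintedMap ((ZMod k × Bool) × ZigzagKind) where
  face :=
    { toFun := fun p => match p with
        | ((i, s), .rim) => ((i + 1, s), .rim)
        | ((i, s), .base) => ((i, s), .out)
        | ((i, s), .out) => ((i, s), .zig)
        | ((i, s), .zig) => ((i, s), .zag)
        | ((i, s), .zag) => ((i + 1, s), .inn)
        | ((i, s), .inn) => ((i - 1, s), .base)
      invFun := fun p => match p with
        | ((i, s), .rim) => ((i - 1, s), .rim)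
        | ((i, s), .out) => ((i, s), .base)
        | ((i, s), .zig) => ((i, s), .out)
        | ((i, s), .zag) => ((i, s), .zig)
        | ((i, s), .inn) => ((i - 1, s), .zag)
        | ((i, s), .base) => ((i + 1, s), .inn)
      left_inv := by rintro ⟨⟨i, s⟩, _ | _ | _ | _ | _ | _⟩ <;> simp
      right_inv := by rintro ⟨⟨i, s⟩, _ | _ | _ | _ | _ | _⟩ <;> simp }
  edge := Function.Involutive.toPerm
    (fun p => match p with
      | ((i, s), .rim) => ((i, s), .base)
      | ((i, s), .base) => ((i, s), .rim)
      | ((i, s), .out) => ((i, s), .inn)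
      | ((i, s), .inn) => ((i, s), .out)
      | ((i, s), .zig) => ((-i, !s), .zig)
      | ((i, s), .zag) => ((-i - 1, !s), .zag))
    (by rintro ⟨⟨i, s⟩, _ | _ | _ | _ | _ | _⟩ <;> simp)
  edge_edge := by
    rintro ⟨⟨i, s⟩, _ | _ | _ | _ | _ | _⟩ <;> simp [Function.Involutive.toPerm]
  edge_ne := by
    rintro ⟨⟨i, s⟩, _ | _ | _ | _ | _ | _⟩ <;> simp [Function.Involutive.toPerm]
  black := {p | p.2 = .rim}
  black_face := by rintro ⟨⟨i, s⟩, _ | _ | _ | _ | _ | _⟩ <;> simp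

/-! ### The list of triples -/

/-- The sporadic triples `(k, l, n)`. -/
def sporadicTriples : Finset (ℕ × ℕ × ℕ) :=
  {(3, 3, 1), (3, 4, 1), (4, 3, 1), (3, 5, 1), (5, 3, 1),
   (3, 6, 2), (3, 8, 2), (4, 6, 2), (3, 10, 2), (5, 6, 2),
   (3, 6, 3), (4, 6, 3), (5, 6, 3),
   (3, 6, 6), (4, 6, 6), (5, 6, 6)}

/-- The pairs `(l, n)` of the infinite sequences `(k, l, n)` with variable `k`. -/
def infiniteSequences : Finset (ℕ × ℕ) := {(4, 2), (3, 3), (4, 4), (5, 5)}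

/-! Let B and W be the numbers of black and white faces. Crossing edges matches black darts with the
white darts at position 0 modulo n of their faces, and each of the n position classes has the same
size. Hence l is a multiple mn of n, kB = mW, and there are (n+1)kB darts. Since every vertex has
valence at least three, Euler's formula becomes 12 + (n+1)kB ≤ 6B + 6W (`euler_le`). For n = 1 the
colours alternate around each vertex, so valences are even and 4 + kB ≤ 2B + 2W (`euler_le_of_one`).

Eliminating B and W gives (n+1)km < 6m + 6k, and km < 2m + 2k when n = 1. These leave finitely many
pairs (m, n), and k is bounded except for the four infinite sequences (`classification`).

The same inequalities give the minimal B and W for each type, with one exception: for (k, 4, 4) they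
allow B = 1 when k is large. There a discharging argument distributes total weight 3kB over the
vertices so that each receives at least 2 (`exists_weight`). Thus 2V ≤ 3kB, and Euler's formula
forces B ≥ 2 (`two_le_numBlack`).

For existence, all models are checked through one recipe, `isFootballPattern_of_phase`.
Rectification, truncation, variation and subdivision are treated once for all regular maps with
suitable parameters and then applied to the Platonic solids and the American football; the three
remaining families are checked directly. -/

/-! ### Counting cycles of a permutation. -/

namespace Equiv.Perm

variable {D : Type} (σ : Equiv.Perm D)

/-- The cycle of a point. -/
def cycleMk (d : D) : Quotient (SameCycle.setoid σ) := Quotient.mk _ d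

theorem cycleMk_eq_iff {a b : D} : σ.cycleMk a = σ.cycleMk b ↔ σ.SameCycle a b :=
  Quotient.eq (r := SameCycle.setoid σ)

theorem cycleMk_surjective : Function.Surjective σ.cycleMk := Quotient.mk_surjective

theorem card_sameCycle [Finite D] (d : D) :
    Nat.card {x // σ.SameCycle d x} = Function.minimalPeriod σ d := by
  classical
  have := Fintype.ofFinite D
  have := Fintype.ofFinite (MulAction.orbit (Subgroup.zpowers σ) d)
  have h := MulAction.minimalPeriod_eq_card (a := σ) (b := d)
  have h1 : (fun x : D => σ • x) = σ := rfl
  rw [h1] at h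
  rw [h, ← Nat.card_eq_fintype_card]
  refine Nat.card_congr (Equiv.subtypeEquivRight fun x => ?_)
  constructor
  · rintro ⟨i, hi⟩
    exact ⟨⟨σ ^ i, i, rfl⟩, hi⟩
  · rintro ⟨⟨_, i, rfl⟩, hi⟩
    exact ⟨i, hi⟩

theorem SameCycle.mem_iff {σ : Equiv.Perm D} {S : Set D} (hS : ∀ d, σ d ∈ S ↔ d ∈ S) {a b : D}
    (h : σ.SameCycle a b) : a ∈ S ↔ b ∈ S := by
  obtain ⟨i, rfl⟩ := h
  have key : ∀ n : ℕ, ∀ x, (σ ^ n) x ∈ S ↔ x ∈ S := by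
    intro n
    induction n with
    | zero => simp
    | succ n ih => intro x; rw [pow_succ', Equiv.Perm.mul_apply, hS, ih]
  cases i with
  | ofNat n => simpa using (key n a).symm
  | negSucc n =>
    rw [zpow_negSucc]
    have := key (n + 1) (((σ ^ (n + 1))⁻¹) a)
    rwa [← Equiv.Perm.mul_apply, mul_inv_cancel, Equiv.Perm.one_apply] at this

/-- An invariant set on which all cycles have length `q`. -/
theorem ncard_eq_mul_ncard_image [Finite D] {S : Set D} {q : ℕ} (hS : ∀ d, σ d ∈ S ↔ d ∈ S)
    (hq : ∀ d ∈ S, Function.minimalPeriod σ d = q) :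
    S.ncard = q * (σ.cycleMk '' S).ncard := by
  classical
  have := Fintype.ofFinite D
  rw [Set.ncard_eq_toFinset_card', Set.ncard_eq_toFinset_card' (σ.cycleMk '' S), mul_comm]
  rw [Finset.card_eq_sum_card_fiberwise (f := σ.cycleMk) (t := (σ.cycleMk '' S).toFinset),
    Finset.sum_const_nat (m := q)]
  · intro t ht
    obtain ⟨d, hd, rfl⟩ : ∃ d ∈ S, σ.cycleMk d = t := by simpa using ht
    rw [← hq d hd, ← card_sameCycle, Nat.card_eq_fintype_card, Fintype.card_subtype]
    congr 1
    ext x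
    simp only [Finset.mem_filter, Set.mem_toFinset, cycleMk_eq_iff, Finset.mem_univ, true_and]
    exact ⟨fun h => h.2.symm, fun h => ⟨(h.mem_iff hS).1 hd, h.symm⟩⟩
  · intro d hd
    simp only [Set.coe_toFinset] at hd ⊢
    exact ⟨d, hd, rfl⟩

/-- If every cycle has weight at least `q`, then the number of cycles is bounded. -/
theorem mul_card_cycles_le [Fintype D] [DecidableEq D] (q : ℕ) (c : D → ℕ)
    (h : ∀ d, ∃ s : Finset D, (∀ x ∈ s, σ.SameCycle d x) ∧ q ≤ ∑ x ∈ s, c x) :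
    q * Nat.card (Quotient (SameCycle.setoid σ)) ≤ ∑ x, c x := by
  classical
  have : Fintype (Quotient (SameCycle.setoid σ)) := Fintype.ofFinite _
  rw [← Finset.sum_fiberwise (s := Finset.univ) (g := σ.cycleMk) (f := c), Nat.card_eq_fintype_card,
    mul_comm, ← smul_eq_mul, ← Finset.card_univ, ← Finset.sum_const]
  refine Finset.sum_le_sum fun t _ => ?_
  obtain ⟨d, rfl⟩ := σ.cycleMk_surjective t
  obtain ⟨s, hs, hq⟩ := h d
  refine hq.trans (Finset.sum_le_sum_of_subset fun x hx => ?_)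
  simpa [cycleMk_eq_iff] using (hs x hx).symm

/-- Unit weights on full cycles; applied to the vertex permutation, this turns a lower bound for the
valences into an upper bound for the number of vertices. -/
theorem mul_card_cycles_le_card [Finite D] {q : ℕ}
    (h : ∀ d, q ≤ Function.minimalPeriod σ d) :
    q * Nat.card (Quotient (SameCycle.setoid σ)) ≤ Nat.card D := by
  classical
  have := Fintype.ofFinite D
  have := mul_card_cycles_le σ q (fun _ => 1) (fun d => ⟨Finset.univ.filter (σ.SameCycle d),
    by simp, by
      rw [← Finset.card_eq_sum_ones, ← Fintype.card_subtype, ← Nat.card_eq_fintype_card,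
        card_sameCycle]
      exact h d⟩)
  simpa [Nat.card_eq_fintype_card] using this

theorem card_cycles_eq [Finite D] {S : Set D} (hS : ∀ d, σ d ∈ S ↔ d ∈ S) :
    Nat.card (Quotient (SameCycle.setoid σ)) =
      (σ.cycleMk '' S).ncard + (σ.cycleMk '' Sᶜ).ncard := by
  rw [← Set.ncard_univ, ← Set.ncard_union_eq, ← Set.image_union, Set.union_compl_self,
    Set.image_univ_of_surjective σ.cycleMk_surjective]
  rw [Set.disjoint_left]
  rintro _ ⟨a, ha, rfl⟩ ⟨b, hb, h⟩
  exact hb (((σ.cycleMk_eq_iff.1 h).mem_iff hS).2 ha)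

theorem card_eq_mul_card_cycles [Finite D] {q : ℕ} (hq : ∀ d, Function.minimalPeriod σ d = q) :
    Nat.card D = q * Nat.card (Quotient (SameCycle.setoid σ)) := by
  have h := ncard_eq_mul_ncard_image σ (S := _root_.Set.univ) (by simp) (fun d _ => hq d)
  rwa [Set.image_univ_of_surjective σ.cycleMk_surjective, Set.ncard_univ, Set.ncard_univ] at h

end Equiv.Perm

open Equiv.Perm

/-! ### Phases on white faces and the dart counts. -/

namespace PaintedMap.IsFootballPattern

variable {D : Type} {P : PaintedMap D} {k l n : ℕ}

/-- `white_meets` supplies a residue for each dart separately. Comparing the residues of consecutive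
darts shows that they fit together to a position in `ZMod n` along each white face, measured from
the edges that meet black faces. -/
theorem exists_phase (h : P.IsFootballPattern k l n) :
    ∃ φ : D → ZMod n, (∀ d ∉ P.black, φ (P.face d) = φ d + 1) ∧
      ∀ d ∉ P.black, (P.edge d ∈ P.black ↔ φ d = 0) := by
  classical
  choose! r hr using h.white_meets
  refine ⟨fun d => -(r d : ZMod n), fun d hd => ?_, fun d hd => ?_⟩
  -- Position `r (P.face d)` counted from `P.face d` is one more when counted from `d`, so residues
  -- drop by one along the face; their negatives increase.
  · have h1 := (hr (P.face d) (by rwa [P.black_face]) (r (P.face d))).2 rfl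
    rw [← Function.iterate_succ_apply, hr d hd, ← ZMod.natCast_eq_natCast_iff] at h1
    change -(r (P.face d) : ZMod n) = -(r d : ZMod n) + 1
    rw [← h1]
    push_cast
    ring
  · have h1 := hr d hd 0
    rw [← ZMod.natCast_eq_natCast_iff] at h1
    rw [neg_eq_zero, ← Function.iterate_zero_apply P.face d, h1, Nat.cast_zero, eq_comm]
    rfl

theorem phase_iterate {φ : D → ZMod n} (hφ : ∀ d ∉ P.black, φ (P.face d) = φ d + 1) {d : D}
    (hd : d ∉ P.black) (i : ℕ) : P.face^[i] d ∉ P.black ∧ φ (P.face^[i] d) = φ d + i := by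
  induction i with
  | zero => simpa using hd
  | succ i ih =>
    rw [Function.iterate_succ_apply', P.black_face]
    refine ⟨ih.1, ?_⟩
    rw [hφ _ ih.1, ih.2]
    push_cast
    ring

/-- An empty map would have Euler characteristic 0; connectedness alone does not exclude it. -/
theorem nonempty (h : P.IsFootballPattern k l n) : Nonempty D := by
  by_contra hD
  rw [not_nonempty_iff] at hD
  have e := h.spherical.euler
  have h1 : IsEmpty P.toCombMap.Vertex := ⟨fun v => Quotient.inductionOn v hD.elim⟩
  have h2 : IsEmpty P.toCombMap.Edge := ⟨fun v => Quotient.inductionOn v hD.elim⟩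
  have h3 : IsEmpty P.toCombMap.Face := ⟨fun v => Quotient.inductionOn v hD.elim⟩
  simp at e

theorem exists_white (h : P.IsFootballPattern k l n) : ∃ d, d ∉ P.black := by
  obtain ⟨d⟩ := h.nonempty
  by_cases hd : d ∈ P.black
  · exact ⟨_, h.black_meets d hd⟩
  · exact ⟨d, hd⟩

theorem exists_black (h : P.IsFootballPattern k l n) : ∃ d, d ∈ P.black := by
  obtain ⟨d, hd⟩ := h.exists_white
  obtain ⟨r, hr⟩ := h.white_meets d hd
  exact ⟨_, (hr r).2 rfl⟩

/-- A full turn around a white face adds `l` to the phase and returns to the same dart. -/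
theorem dvd (h : P.IsFootballPattern k l n) : n ∣ l := by
  obtain ⟨φ, hφ, -⟩ := h.exists_phase
  obtain ⟨d, hd⟩ := h.exists_white
  have h1 := (phase_iterate hφ hd l).2
  rw [← h.white_gon d hd, Function.iterate_minimalPeriod, left_eq_add] at h1
  rwa [ZMod.natCast_eq_zero_iff, h.white_gon d hd] at h1

theorem ncard_black (h : P.IsFootballPattern k l n) : P.black.ncard = k * P.numBlack :=
  have := h.spherical.finite
  ncard_eq_mul_ncard_image P.face P.black_face h.black_gon

theorem ncard_white (h : P.IsFootballPattern k l n) : P.blackᶜ.ncard = l * P.numWhite :=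
  have := h.spherical.finite
  ncard_eq_mul_ncard_image P.face (fun d => not_congr (P.black_face d)) h.white_gon

/-- `P.edge` is a bijection from the black darts to the white darts of phase 0, and `P.face` is a
bijection from each phase class to the next, so all `n` classes are as large as the set of black
darts. -/
theorem ncard_white_eq (h : P.IsFootballPattern k l n) (hl : 0 < l) :
    P.blackᶜ.ncard = n * P.black.ncard := by
  classical
  have := h.spherical.finite
  obtain ⟨φ, hφ, hφ0⟩ := h.exists_phase
  -- This is where `0 < l` enters: `n = 0` would divide only `l = 0`, and `ZMod n` has to be finite.
  have hn : NeZero n := ⟨fun hn => by have := h.dvd; rw [hn, zero_dvd_iff] at this; omega⟩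
  have key : ∀ j : ℕ, {d | d ∉ P.black ∧ φ d = j}.ncard = P.black.ncard := by
    intro j
    induction j with
    | zero =>
      symm
      refine Set.ncard_congr (fun d _ => P.edge d) (fun d hd => ?_) (by simp) (fun d hd => ?_)
      · refine ⟨h.black_meets d hd, ?_⟩
        rw [Nat.cast_zero, ← hφ0 _ (h.black_meets d hd), P.edge_edge]
        exact hd
      · refine ⟨P.edge d, ?_, P.edge_edge d⟩
        rw [hφ0 d hd.1, hd.2, Nat.cast_zero]
    | succ j ih =>
      rw [← ih]
      symm
      refine Set.ncard_congr (fun d _ => P.face d) (fun d hd => ?_) (by simp) (fun d hd => ?_)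
      · refine ⟨by rw [P.black_face]; exact hd.1, ?_⟩
        rw [hφ d hd.1, hd.2, Nat.cast_succ]
      · obtain ⟨e, rfl⟩ := P.face.surjective d
        have he : e ∉ P.black := by rw [← P.black_face]; exact hd.1
        refine ⟨e, ⟨he, ?_⟩, rfl⟩
        have := hd.2
        rwa [hφ e he, Nat.cast_succ, add_left_inj] at this
  have := Fintype.ofFinite D
  rw [Set.ncard_eq_toFinset_card', Finset.card_eq_sum_card_fiberwise (f := φ) (t := Finset.univ)
    (by simp), Finset.sum_const_nat (m := P.black.ncard), Finset.card_univ, ZMod.card]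
  intro z _
  obtain ⟨j, rfl⟩ := ZMod.natCast_zmod_surjective z
  rw [← key j, Set.ncard_eq_toFinset_card']
  congr 1
  ext d
  simp

theorem mul_numBlack_eq (h : P.IsFootballPattern k l n) (hl : 0 < l) :
    n * (k * P.numBlack) = l * P.numWhite := by
  rw [← h.ncard_white, h.ncard_white_eq hl, h.ncard_black]

theorem card_darts (h : P.IsFootballPattern k l n) (hl : 0 < l) :
    Nat.card D = (n + 1) * (k * P.numBlack) := by
  have := h.spherical.finite
  rw [← Set.ncard_add_ncard_compl P.black, h.ncard_white_eq hl, h.ncard_black]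
  ring

theorem numBlack_pos (h : P.IsFootballPattern k l n) : 0 < P.numBlack := by
  have := h.spherical.finite
  obtain ⟨d, hd⟩ := h.exists_black
  have : Finite P.toCombMap.Face := Quotient.finite _
  exact (Set.ncard_pos).2 ⟨_, d, hd, rfl⟩

end PaintedMap.IsFootballPattern

/-! ### Euler's formula and the two basic inequalities. -/

namespace CombMap

variable {D : Type} (M : CombMap D)

theorem minimalPeriod_edge (d : D) : Function.minimalPeriod M.edge d = 2 :=
  Function.minimalPeriod_eq_prime (M.edge_edge d) (M.edge_ne d)

theorem card_darts_eq [Finite D] : Nat.card D = 2 * Nat.card M.Edge :=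
  card_eq_mul_card_cycles M.edge M.minimalPeriod_edge

end CombMap

namespace PaintedMap

variable {D : Type} (P : PaintedMap D)

theorem card_face [Finite D] : Nat.card P.toCombMap.Face = P.numBlack + P.numWhite :=
  card_cycles_eq P.face P.black_face

namespace IsFootballPattern

variable {P} {k l n : ℕ}

/-- Euler's formula, doubled. -/
theorem two_mul_card_vertex (h : P.IsFootballPattern k l n) (hl : 0 < l) :
    2 * Nat.card P.toCombMap.Vertex + 2 * P.numBlack + 2 * P.numWhite =
      (n + 1) * (k * P.numBlack) + 4 := by
  have := h.spherical.finite
  have h1 := h.spherical.euler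
  have h2 := P.toCombMap.card_darts_eq
  have h3 := P.card_face
  have h4 := h.card_darts hl
  omega

/-- The inequality between the numbers of faces for vertices of valence at least three. -/
theorem euler_le (h : P.IsFootballPattern k l n) (hl : 0 < l) :
    12 + (n + 1) * (k * P.numBlack) ≤ 6 * P.numBlack + 6 * P.numWhite := by
  have := h.spherical.finite
  have h1 := h.two_mul_card_vertex hl
  have h2 : 3 * Nat.card P.toCombMap.Vertex ≤ Nat.card D :=
    mul_card_cycles_le_card P.toCombMap.vertex h.valence
  rw [h.card_darts hl] at h2
  omega

theorem edge_mem_black_iff (h : P.IsFootballPattern k l 1) (d : D) :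
    P.edge d ∈ P.black ↔ d ∉ P.black := by
  refine ⟨fun h1 h2 => h.black_meets d h2 h1, fun hd => ?_⟩
  obtain ⟨r, hr⟩ := h.white_meets d hd
  exact (hr 0).2 (Nat.modEq_one)

theorem vertex_mem_black_iff (h : P.IsFootballPattern k l 1) (d : D) :
    P.toCombMap.vertex d ∈ P.black ↔ d ∉ P.black := by
  rw [← h.edge_mem_black_iff]
  exact P.black_face _

/-- Turning about a vertex changes the colour at every step, so no vertex cycle has length three. -/
theorem four_le_valence (h : P.IsFootballPattern k l 1) (d : D) :
    4 ≤ Function.minimalPeriod P.toCombMap.vertex d := by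
  have h3 := h.valence d
  by_contra hc
  have h4 : Function.minimalPeriod P.toCombMap.vertex d = 3 := by omega
  have h5 := Function.iterate_minimalPeriod (f := P.toCombMap.vertex) (x := d)
  rw [h4] at h5
  have h6 := h.vertex_mem_black_iff (P.toCombMap.vertex (P.toCombMap.vertex d))
  simp only [Function.iterate_succ, Function.iterate_zero, Function.comp_apply, id] at h5
  rw [h5, h.vertex_mem_black_iff, h.vertex_mem_black_iff] at h6
  tauto

/-- The inequality between the numbers of faces for vertices of valence at least four. -/
theorem euler_le_of_one (h : P.IsFootballPattern k l 1) (hl : 0 < l) :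
    4 + k * P.numBlack ≤ 2 * P.numBlack + 2 * P.numWhite := by
  have := h.spherical.finite
  have h1 := h.two_mul_card_vertex hl
  have h2 : 4 * Nat.card P.toCombMap.Vertex ≤ Nat.card D :=
    mul_card_cycles_le_card P.toCombMap.vertex h.four_le_valence
  rw [h.card_darts hl] at h2
  omega

/-! ### Discharging for the type (k, 4, 4). -/

open Classical in
/-- The weight of a dart in the vertex count for patterns of type `(k, 4, 4)`: only darts between
white faces count, and the two darts of an edge leading to the corner of a black face where only
three edges meet are moved to that corner. -/
noncomputable def weight (P : PaintedMap D) (φ : D → ZMod 4) (x : D) : ℕ :=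
  if x ∈ P.black ∨ P.edge x ∈ P.black then 0
  else if φ x = 1 ∧ φ (P.edge x) = 3 then 2
  else if φ x = 3 ∧ φ (P.edge x) = 1 then 0 else 1

/-- An edge between two white faces carries total weight 2 and any other edge carries 0, however the
weight is shared between its darts. Of the 5kB darts, 2kB lie on edges of black faces. -/
theorem sum_weight [Fintype D] (φ : D → ZMod 4) (h : P.IsFootballPattern k 4 4) :
    ∑ x, weight P φ x = 3 * P.black.ncard := by
  classical
  have e1 : ∑ x, weight P φ x = ∑ x, weight P φ (P.edge x) :=
    (Equiv.sum_comp P.edge (weight P φ)).symm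
  -- No edge has two black sides, so exactly one of the correction terms compensates for an edge of
  -- weight zero.
  have e2 : ∀ x, weight P φ x + weight P φ (P.edge x) + ((if x ∈ P.black then 2 else 0) +
      (if P.edge x ∈ P.black then 2 else 0)) = 2 := by
    intro x
    have h0 : (1 : ZMod 4) ≠ 3 := by decide
    have h1 := h.black_meets x
    rw [weight, weight, P.edge_edge]
    split_ifs <;> simp_all
  have e3 : ∑ x, (if P.edge x ∈ P.black then 2 else 0) = ∑ x, (if x ∈ P.black then 2 else 0) :=
    Equiv.sum_comp P.edge (fun x => if x ∈ P.black then 2 else 0)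
  have e4 : ∑ x, (if x ∈ P.black then 2 else 0) = 2 * P.black.ncard := by
    rw [← Finset.sum_filter, Finset.sum_const, smul_eq_mul, mul_comm, Set.ncard_eq_toFinset_card']
    congr 2
    ext; simp
  have e5 := Finset.sum_congr (rfl : (Finset.univ : Finset D) = _) (fun x _ => e2 x)
  rw [Finset.sum_add_distrib, Finset.sum_add_distrib, Finset.sum_add_distrib, ← e1, e3, e4,
    Finset.sum_const, smul_eq_mul, Finset.card_univ, ← Nat.card_eq_fintype_card,
    h.card_darts (by norm_num), ← h.ncard_black] at e5
  omega

/-- If a dart at the vertex has given its weight away, its two neighbours in the vertex cycle keep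
weight 1 each, because phase 2 is involved in neither transfer. Otherwise all darts of nonzero phase
at the vertex keep at least weight 1; either there are two of them, or the vertex is a trivalent
corner of a black face whose only such dart has received weight 2. -/
theorem exists_weight [Fintype D] {φ : D → ZMod 4} (h : P.IsFootballPattern k 4 4)
    (hφ : ∀ d ∉ P.black, φ (P.face d) = φ d + 1)
    (hφ0 : ∀ d ∉ P.black, (P.edge d ∈ P.black ↔ φ d = 0)) (d : D) :
    ∃ s : Finset D, (∀ x ∈ s, P.toCombMap.vertex.SameCycle d x) ∧ 2 ≤ ∑ x ∈ s, weight P φ x := by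
  classical
  set v := P.toCombMap.vertex with hv
  have v_def : ∀ x, v x = P.face (P.edge x) := fun _ => rfl
  have of_one : ∀ x, v.SameCycle d x → 2 ≤ weight P φ x →
      ∃ s : Finset D, (∀ x ∈ s, v.SameCycle d x) ∧ 2 ≤ ∑ x ∈ s, weight P φ x :=
    fun x hx h2 => ⟨{x}, by simpa using hx, by simpa using h2⟩
  have of_two : ∀ x y, v.SameCycle d x → v.SameCycle d y → x ≠ y → 1 ≤ weight P φ x →
      1 ≤ weight P φ y → ∃ s : Finset D, (∀ x ∈ s, v.SameCycle d x) ∧ 2 ≤ ∑ x ∈ s, weight P φ x :=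
    fun x y hx hy hxy h1 h2 => ⟨{x, y}, by simp [hx, hy], by rw [Finset.sum_pair hxy]; omega⟩
  have period : ∀ x, v x ≠ x ∧ v (v x) ≠ x := by
    intro x
    have h3 : 3 ≤ Function.minimalPeriod v x := h.valence x
    constructor
    · intro hx
      have := Function.IsPeriodicPt.minimalPeriod_le (f := v) (x := x) (n := 1) one_pos hx
      omega
    · intro hx
      have := Function.IsPeriodicPt.minimalPeriod_le (f := v) (x := x) (n := 2) two_pos hx
      omega
  have white_black : ∀ x ∈ P.black, P.edge x ∉ P.black ∧ φ (P.edge x) = 0 := by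
    intro x hx
    have h1 := h.black_meets x hx
    refine ⟨h1, ?_⟩
    rwa [← hφ0 _ h1, P.edge_edge]
  have step : ∀ x, P.edge x ∉ P.black → v x ∉ P.black ∧ φ (v x) = φ (P.edge x) + 1 := by
    intro x hx
    rw [v_def, P.black_face]
    exact ⟨hx, hφ _ hx⟩
  have step_black : ∀ x ∈ P.black, v x ∉ P.black ∧ φ (v x) = 1 := by
    intro x hx
    obtain ⟨h1, h2⟩ := white_black x hx
    obtain ⟨h3, h4⟩ := step x h1
    exact ⟨h3, by rw [h4, h2, zero_add]⟩
  have sc : ∀ x, v.SameCycle d x → v.SameCycle d (v x) := fun x hx =>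
    Equiv.Perm.sameCycle_apply_right.2 hx
  by_cases hA : ∃ x, v.SameCycle d x ∧ x ∉ P.black ∧ P.edge x ∉ P.black ∧ φ x = 3 ∧
      φ (P.edge x) = 1
  -- Here `x` has weight 0. Its successor has phase 2, and its predecessor `P.edge w` is the reverse
  -- of a dart of phase 2.
  · obtain ⟨x, hx, hxb, hxe, h3, h1⟩ := hA
    obtain ⟨hy1, hy2⟩ := step x hxe
    rw [h1] at hy2
    obtain ⟨w, rfl⟩ := P.face.surjective x
    have hw : w ∉ P.black := by rwa [P.black_face] at hxb
    have hw2 : φ w = 2 := by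
      have := hφ w hw
      rw [h3] at this
      exact add_right_cancel (this.symm.trans (by decide : (3 : ZMod 4) = 2 + 1))
    have hwe : P.edge w ∉ P.black := by rw [hφ0 w hw, hw2]; decide
    have hvz : v (P.edge w) = P.face w := by rw [v_def, P.edge_edge]
    have hye : P.edge (v (P.face w)) ∉ P.black := by rw [hφ0 _ hy1, hy2]; decide
    refine of_two (v (P.face w)) (P.edge w) (sc _ hx) ?_ ?_ ?_ ?_
    · rw [← hvz] at hx
      exact Equiv.Perm.sameCycle_apply_right.1 hx
    -- Equality would make the vertex cycle have length at most two.
    · intro he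
      apply (period (P.edge w)).2
      rw [hvz, he]
    · rw [weight, if_neg (by tauto), hy2, if_neg (fun h => absurd h.1 (by decide)),
        if_neg (fun h => absurd h.1 (by decide))]
    · rw [weight, P.edge_edge, if_neg (by tauto), hw2, if_neg (fun h => absurd h.2 (by decide)),
        if_neg (fun h => absurd h.2 (by decide))]
  · push Not at hA
    have pos : ∀ x, v.SameCycle d x → x ∉ P.black → φ x ≠ 0 → 1 ≤ weight P φ x := by
      intro x hx h1 h2
      have h3 : P.edge x ∉ P.black := by rwa [hφ0 x h1]
      have h4 := hA x hx h1 h3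
      rw [weight, if_neg (by tauto)]
      split_ifs with h5 h6
      · exact one_le_two
      · exact absurd h6.2 (h4 h6.1)
      · exact le_rfl
    -- Immediately after a black dart comes a dart of phase 1, and after a white dart of phase 0
    -- comes a black dart; so at most two steps are needed.
    have ex : ∃ x, v.SameCycle d x ∧ x ∉ P.black ∧ φ x ≠ 0 := by
      by_cases hd : d ∈ P.black
      · obtain ⟨h1, h2⟩ := step_black d hd
        exact ⟨v d, sc _ (Equiv.Perm.SameCycle.refl _ _), h1, by rw [h2]; decide⟩
      · by_cases hd0 : φ d = 0
        · have h3 : v d ∈ P.black := by rw [v_def, P.black_face]; exact (hφ0 d hd).2 hd0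
          obtain ⟨h1, h2⟩ := step_black _ h3
          exact ⟨v (v d), sc _ (sc _ (Equiv.Perm.SameCycle.refl _ _)), h1, by rw [h2]; decide⟩
        · exact ⟨d, Equiv.Perm.SameCycle.refl _ _, hd, hd0⟩
    obtain ⟨x, hx, h1, h2⟩ := ex
    have hxe : P.edge x ∉ P.black := by rwa [hφ0 x h1]
    obtain ⟨h3, h4⟩ := step x hxe
    by_cases h5 : φ (v x) = 0
    · have h6 : v (v x) ∈ P.black := by
        rw [v_def (v x), P.black_face]
        exact (hφ0 _ h3).2 h5
      obtain ⟨h7, h8⟩ := step_black _ h6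
      have hs := sc _ (sc _ (sc _ hx))
      -- The cycle so far is `x`, then phase 0, then black, then phase 1. If it closes up here, `x`
      -- has phase 1 and its reverse phase 3, so it has received weight 2.
      by_cases h9 : v (v (v x)) = x
      · refine of_one x hx ?_
        rw [h9] at h8
        have h10 : φ (P.edge x) = 3 := by
          rw [h5] at h4
          exact add_right_cancel (h4.symm.trans (by decide : (0 : ZMod 4) = 3 + 1))
        rw [weight, if_neg (by tauto), if_pos ⟨h8, h10⟩]
      · exact of_two _ _ hs hx h9 (pos _ hs h7 (by rw [h8]; decide)) (pos _ hx h1 h2)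
    · exact of_two _ _ (sc _ hx) hx (period x).1 (pos _ (sc _ hx) h3 h5) (pos _ hx h1 h2)

/-- With W = kB, Euler's formula reads 2V + 2B = 3kB + 4, while the weights give 2V ≤ 3kB. -/
theorem two_le_numBlack (h : P.IsFootballPattern k 4 4) : 2 ≤ P.numBlack := by
  classical
  have := h.spherical.finite
  have := Fintype.ofFinite D
  obtain ⟨φ, hφ, hφ0⟩ := h.exists_phase
  have h1 := mul_card_cycles_le P.toCombMap.vertex 2 (weight P φ) (h.exists_weight hφ hφ0)
  rw [sum_weight φ h, h.ncard_black] at h1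
  have h2 := h.two_mul_card_vertex (by norm_num)
  have h3 := h.mul_numBlack_eq (by norm_num)
  change 2 * Nat.card P.toCombMap.Vertex ≤ _ at h1
  omega

end IsFootballPattern

end PaintedMap

/-! ### Periods, connectedness and the recipe for constructing patterns. -/

/-- In the constructions, suitable powers of the face and vertex permutations act on the darts of
one kind as permutations of the original darts. This transfers the known periods. -/
theorem Function.minimalPeriod_of_semiconj {α β : Type*} {f : α → α} {g : β → β} {ι : α → β}
    (h : Function.Semiconj ι f g) (hι : Function.Injective ι) (a : α) :
    Function.minimalPeriod g (ι a) = Function.minimalPeriod f a := by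
  rw [Function.minimalPeriod_eq_minimalPeriod_iff]
  intro n
  rw [Function.IsPeriodicPt, Function.IsPeriodicPt, Function.IsFixedPt, Function.IsFixedPt,
    ← (h.iterate_right n).eq, hι.eq_iff]

theorem Equiv.Perm.minimalPeriod_symm {D : Type} (σ : Equiv.Perm D) (d : D) :
    Function.minimalPeriod σ.symm d = Function.minimalPeriod σ d := by
  rw [Function.minimalPeriod_eq_minimalPeriod_iff]
  intro n
  rw [Function.IsPeriodicPt, Function.IsPeriodicPt, Function.IsFixedPt, Function.IsFixedPt]
  have h1 : Function.LeftInverse σ.symm^[n] σ^[n] := Function.LeftInverse.iterate σ.symm_apply_apply n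
  have h2 : Function.LeftInverse σ^[n] σ.symm^[n] := Function.LeftInverse.iterate σ.apply_symm_apply n
  constructor
  · intro h
    rw [← h, h2, h]
  · intro h
    rw [← h, h1, h]

/-- Connectedness in terms of equivalence relations. -/
theorem isPretransitive_closure_iff {D : Type} (f e : Equiv.Perm D) :
    MulAction.IsPretransitive (Subgroup.closure {f, e}) D ↔
      ∀ s : Setoid D, (∀ d, s d (f d)) → (∀ d, s d (e d)) → ∀ a b, s a b := by
  constructor
  · intro h s hf he a b
    obtain ⟨⟨g, hg⟩, rfl⟩ := MulAction.exists_smul_eq (Subgroup.closure {f, e}) a b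
    change s a (g a)
    have key : ∀ x, s x (g x) := by
      induction hg using Subgroup.closure_induction with
      | mem g hg =>
        rcases hg with rfl | rfl
        · exact hf
        · exact he
      | one => exact fun x => s.refl x
      | mul g g' _ _ ih ih' => exact fun x => s.trans (ih' x) (ih (g' x))
      | inv g _ ih =>
        intro x
        have := ih (g⁻¹ x)
        rw [← Equiv.Perm.mul_apply, mul_inv_cancel, Equiv.Perm.one_apply] at this
        exact s.symm this
    exact key a
  · intro h
    refine ⟨fun a b => ?_⟩
    have := h (MulAction.orbitRel (Subgroup.closure {f, e}) D)
      (fun d => (MulAction.orbitRel _ _).symm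
        ⟨⟨f, Subgroup.subset_closure (Set.mem_insert _ _)⟩, rfl⟩)
      (fun d => (MulAction.orbitRel _ _).symm
        ⟨⟨e, Subgroup.subset_closure (Set.mem_insert_of_mem _ rfl)⟩, rfl⟩) b a
    exact this

namespace PaintedMap

variable {D : Type} {P : PaintedMap D} {k m n : ℕ}

/-- The phase shows that `n` divides the face length, so only the period of the `n`-step map, which
preserves the phase, remains to be found. -/
theorem minimalPeriod_face_of_phase [Finite D] [NeZero n] {φ : D → ZMod n}
    (hφ : ∀ d ∉ P.black, φ (P.face d) = φ d + 1) {d : D} (hd : d ∉ P.black)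
    (hm : Function.minimalPeriod P.face^[n] d = m) : Function.minimalPeriod P.face d = m * n := by
  have h1 := (IsFootballPattern.phase_iterate hφ hd (Function.minimalPeriod P.face d)).2
  rw [Function.iterate_minimalPeriod, left_eq_add, ZMod.natCast_eq_zero_iff] at h1
  rw [Function.minimalPeriod_iterate_eq_div_gcd (NeZero.ne n), Nat.gcd_eq_right h1] at hm
  rw [← hm, Nat.div_mul_cancel h1]

/-- A recipe for football patterns: the white darts carry a phase which tells the position relative
to the edges that meet black faces. -/
theorem isFootballPattern_of_phase [Finite D] [NeZero n] (hk : 0 < k) (hm : 0 < m) {b w v : ℕ}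
    (φ : D → ZMod n)
    (hconn : ∀ s : Setoid D, (∀ d, s d (P.face d)) → (∀ d, s d (P.edge d)) → ∀ a b, s a b)
    (hval : ∀ d, 3 ≤ Function.minimalPeriod P.toCombMap.vertex d)
    (hblack : ∀ d ∈ P.black, Function.minimalPeriod P.face d = k ∧ P.edge d ∉ P.black)
    (hwhite : ∀ d ∉ P.black, φ (P.face d) = φ d + 1 ∧ (P.edge d ∈ P.black ↔ φ d = 0) ∧
      Function.minimalPeriod P.face^[n] d = m)
    (hb : P.black.ncard = k * b) (hw : P.blackᶜ.ncard = m * n * w)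
    (hv : Nat.card P.toCombMap.Vertex = v)
    (heuler : 2 * v + 2 * b + 2 * w = k * b + m * n * w + 4) :
    P.IsFootballPattern k (m * n) n ∧ P.numBlack = b ∧ P.numWhite = w := by
  have hφ : ∀ d ∉ P.black, φ (P.face d) = φ d + 1 := fun d hd => (hwhite d hd).1
  have hwper : ∀ d ∉ P.black, Function.minimalPeriod P.face d = m * n :=
    fun d hd => minimalPeriod_face_of_phase hφ hd (hwhite d hd).2.2
  have hB : P.numBlack = b := by
    have := ncard_eq_mul_ncard_image P.face P.black_face (fun d hd => (hblack d hd).1)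
    rw [hb] at this
    exact (Nat.eq_of_mul_eq_mul_left hk this).symm
  have hW : P.numWhite = w := by
    have := ncard_eq_mul_ncard_image P.face (S := P.blackᶜ)
      (fun d => not_congr (P.black_face d)) hwper
    rw [hw] at this
    exact (Nat.eq_of_mul_eq_mul_left (Nat.mul_pos hm (NeZero.pos n)) this).symm
  refine ⟨⟨⟨inferInstance, (isPretransitive_closure_iff _ _).2 hconn, ?_⟩, hval,
    fun d hd => (hblack d hd).1, hwper, fun d hd => (hblack d hd).2, fun d hd => ?_⟩, hB, hW⟩
  · have h2 := P.toCombMap.card_darts_eq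
    have h3 := P.card_face
    have h4 := Set.ncard_add_ncard_compl P.black
    rw [hb, hw] at h4
    omega
  -- After `i` steps the phase is `φ d + i`, which vanishes exactly when `i` represents `-φ d`.
  · refine ⟨(-φ d).val, fun i => ?_⟩
    obtain ⟨h1, h2⟩ := IsFootballPattern.phase_iterate hφ hd i
    rw [(hwhite _ h1).2.1, h2, ← ZMod.natCast_eq_natCast_iff, ZMod.natCast_zmod_val,
      eq_neg_iff_add_eq_zero, add_comm]

end PaintedMap

/-! ### Regular maps and their duals. -/

namespace CombMap

/-- A connected map with `N` darts all of whose faces are `p`-gons and all of whose vertices have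
valence `q`. -/
structure IsRegular {D : Type} (M : CombMap D) (p q N : ℕ) : Prop where
  finite : Finite D
  card : Nat.card D = N
  connected : ∀ s : Setoid D, (∀ d, s d (M.face d)) → (∀ d, s d (M.edge d)) → ∀ a b, s a b
  face_period : ∀ d, Function.minimalPeriod M.face d = p
  vertex_period : ∀ d, Function.minimalPeriod M.vertex d = q

variable {D : Type} {M : CombMap D}

theorem vertex_apply (d : D) : M.vertex d = M.face (M.edge d) := rfl

theorem vertex_edge (d : D) : M.vertex (M.edge d) = M.face d := by
  rw [vertex_apply, M.edge_edge]

theorem vertex_symm_apply (d : D) : M.vertex.symm d = M.edge (M.face.symm d) := by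
  rw [Equiv.symm_apply_eq, vertex_apply, M.edge_edge, Equiv.apply_symm_apply]

/-- The faces of the dual are vertex cycles traversed backwards, and `M.edge` conjugates the inverse
of `M.face` to the vertex permutation of the dual. -/
theorem IsRegular.dual {p q N : ℕ} (h : M.IsRegular p q N) : M.dual.IsRegular q p N where
  finite := h.finite
  card := h.card
  connected s hf he := by
    refine h.connected s (fun d => ?_) he
    have h1 := hf (M.face d)
    have h2 : M.dual.face (M.face d) = M.edge d := by
      change M.vertex.symm (M.face d) = _
      rw [vertex_symm_apply, Equiv.symm_apply_apply]
    rw [h2] at h1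
    exact s.trans (he d) (s.symm h1)
  face_period d := by
    rw [← h.vertex_period d]
    exact Equiv.Perm.minimalPeriod_symm _ d
  vertex_period d := by
    rw [← h.face_period (M.edge d), ← Equiv.Perm.minimalPeriod_symm M.face]
    obtain ⟨d, rfl⟩ := M.edge.surjective d
    rw [M.edge_edge]
    refine Function.minimalPeriod_of_semiconj (fun x => ?_) M.edge.injective d
    change _ = M.vertex.symm (M.edge (M.edge x))
    rw [M.edge_edge, vertex_symm_apply]

/-- Since 3 is prime and 4 a prime power, one inequality and one equation determine the period, here
and in `minimalPeriod_vertex_four`. -/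
theorem minimalPeriod_vertex_three {d : D} (h1 : M.vertex d ≠ d)
    (h3 : M.vertex (M.vertex (M.vertex d)) = d) : Function.minimalPeriod M.vertex d = 3 :=
  Function.minimalPeriod_eq_prime (hp := ⟨Nat.prime_three⟩) h3 h1

theorem minimalPeriod_vertex_four {d : D} (h2 : M.vertex (M.vertex d) ≠ d)
    (h4 : M.vertex (M.vertex (M.vertex (M.vertex d))) = d) :
    Function.minimalPeriod M.vertex d = 4 :=
  Function.minimalPeriod_eq_prime_pow (p := 2) (k := 1) h2 h4

end CombMap

/-! ### Counting darts by kind. -/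

/-- The darts of one kind. -/
theorem ncard_kind (D : Type) {K : Type} (a : K) : {p : D × K | p.2 = a}.ncard = Nat.card D := by
  have : {p : D × K | p.2 = a} = Set.range (fun d : D => (d, a)) := by
    ext ⟨d, k⟩
    simp [eq_comm]
  rw [this, ← Set.image_univ, Set.ncard_image_of_injective _ (Prod.mk_left_injective a),
    Set.ncard_univ]

theorem ncard_kind_compl (D : Type) {K : Type} [Finite D] [Finite K] (a : K) {r : ℕ}
    (hr : Nat.card K = r + 1) : {p : D × K | p.2 = a}ᶜ.ncard = r * Nat.card D := by
  have h := Set.ncard_add_ncard_compl {p : D × K | p.2 = a}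
  rw [ncard_kind, Nat.card_prod, hr] at h
  linarith

def RectKind.equivFin : RectKind ≃ Fin 2 where
  toFun | .inner => 0 | .outer => 1
  invFun | 0 => .inner | 1 => .outer
  left_inv := by rintro (_ | _) <;> rfl
  right_inv := by decide

def TruncKind.equivFin : TruncKind ≃ Fin 3 where
  toFun | .cut => 0 | .side => 1 | .rim => 2
  invFun | 0 => .cut | 1 => .side | 2 => .rim
  left_inv := by rintro (_ | _ | _) <;> rfl
  right_inv := by decide

def VarKind.equivFin : VarKind ≃ Fin 4 where
  toFun | .rim => 0 | .base => 1 | .out => 2 | .inn => 3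
  invFun | 0 => .rim | 1 => .base | 2 => .out | 3 => .inn
  left_inv := by rintro (_ | _ | _ | _) <;> rfl
  right_inv := by decide

def SubdivKind.equivFin : SubdivKind ≃ Fin 7 where
  toFun | .rim => 0 | .base => 1 | .out => 2 | .inn => 3 | .first => 4 | .middle => 5 | .last => 6
  invFun | 0 => .rim | 1 => .base | 2 => .out | 3 => .inn | 4 => .first | 5 => .middle | 6 => .last
  left_inv := by rintro (_ | _ | _ | _ | _ | _ | _) <;> rfl
  right_inv := by decide

def PartKind.equivFin : PartKind ≃ Fin 4 where
  toFun | .rim => 0 | .base => 1 | .out => 2 | .inn => 3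
  invFun | 0 => .rim | 1 => .base | 2 => .out | 3 => .inn
  left_inv := by rintro (_ | _ | _ | _) <;> rfl
  right_inv := by decide

def TinKind.equivFin : TinKind ≃ Fin 5 where
  toFun | .rim => 0 | .base => 1 | .out => 2 | .inn => 3 | .equator => 4
  invFun | 0 => .rim | 1 => .base | 2 => .out | 3 => .inn | 4 => .equator
  left_inv := by rintro (_ | _ | _ | _ | _) <;> rfl
  right_inv := by decide

def ZigzagKind.equivFin : ZigzagKind ≃ Fin 6 where
  toFun | .rim => 0 | .base => 1 | .out => 2 | .inn => 3 | .zig => 4 | .zag => 5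
  invFun | 0 => .rim | 1 => .base | 2 => .out | 3 => .inn | 4 => .zig | 5 => .zag
  left_inv := by rintro (_ | _ | _ | _ | _ | _) <;> rfl
  right_inv := by decide

instance : Finite RectKind := .of_equiv _ RectKind.equivFin.symm
instance : Finite TruncKind := .of_equiv _ TruncKind.equivFin.symm
instance : Finite VarKind := .of_equiv _ VarKind.equivFin.symm
instance : Finite SubdivKind := .of_equiv _ SubdivKind.equivFin.symm
instance : Finite PartKind := .of_equiv _ PartKind.equivFin.symm
instance : Finite TinKind := .of_equiv _ TinKind.equivFin.symm
instance : Finite ZigzagKind := .of_equiv _ ZigzagKind.equivFin.symm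

/-! ### The four constructions applied to regular maps. -/

namespace CombMap.IsRegular

variable {D : Type} {M : CombMap D} {p q N b w : ℕ}

theorem vertex_symm_period (h : M.IsRegular p q N) (d : D) :
    Function.minimalPeriod M.vertex.symm d = q := by
  rw [Equiv.Perm.minimalPeriod_symm, h.vertex_period]

/-- The cycles of the vertex permutation, if all of them have the same length. -/
theorem card_vertex {D : Type} {M : CombMap D} [Finite D] {q v : ℕ} (hq : 0 < q)
    (h : ∀ d, Function.minimalPeriod M.vertex d = q) (hD : Nat.card D = q * v) :
    Nat.card M.Vertex = v :=
  Nat.eq_of_mul_eq_mul_left hq ((card_eq_mul_card_cycles M.vertex h).symm.trans hD)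

/-- The new vertices are the midpoints of old edges, all of valence four; `he` is Euler's formula of
the old map and gives their number N/2 = b + w - 2. -/
theorem rectify (h : M.IsRegular p q N) (hp : 0 < p) (hq : 0 < q) (hb : N = p * b)
    (hw : N = q * w) (he : 2 * b + 2 * w = N + 4) :
    M.rectify.IsFootballPattern p (q * 1) 1 ∧ M.rectify.numBlack = b ∧
      M.rectify.numWhite = w := by
  have := h.finite
  have hv : ∀ d, Function.minimalPeriod M.rectify.toCombMap.vertex d = 4 := by
    rintro ⟨d, _ | _⟩
    · refine minimalPeriod_vertex_four (fun hd => ?_) ?_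
      · have h1 : M.face (M.vertex.symm d) = d := congrArg Prod.fst hd
        rw [vertex_symm_apply] at h1
        have h2 : d = M.face (M.face.symm d) := by simp
        exact M.edge_ne _ (M.face.injective (h1.trans h2))
      · change (M.face (M.vertex.symm (M.face (M.vertex.symm d))), RectKind.inner) = _
        simp [vertex_symm_apply, M.edge_edge]
    · refine minimalPeriod_vertex_four (fun hd => ?_) ?_
      · have h1 : M.vertex.symm (M.face d) = d := congrArg Prod.fst hd
        rw [vertex_symm_apply, Equiv.symm_apply_apply] at h1
        exact M.edge_ne _ h1
      · change (M.vertex.symm (M.face (M.vertex.symm (M.face d))), RectKind.outer) = _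
        simp [vertex_symm_apply, M.edge_edge]
  refine PaintedMap.isFootballPattern_of_phase (v := b + w - 2) hp hq (fun _ => 0) ?_ ?_ ?_ ?_ ?_
    ?_ ?_ ?_
  · intro s hf he
    have hio : ∀ d, s (d, .inner) (d, .outer) := fun d => he (d, .inner)
    have key : ∀ a b, s (a, .inner) (b, .inner) := by
      refine h.connected (s.comap fun d => (d, RectKind.inner)) (fun d => hf (d, .inner))
        fun d => ?_
      -- The darts `M.edge d` and `d` are linked by one step along an inner face and one step back
      -- around the vertex on the outer side.
      have h1 : s (M.edge d, .inner) (M.vertex d, .inner) := hf (M.edge d, .inner)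
      have h2 : s (M.vertex d, .outer) (M.vertex.symm (M.vertex d), .outer) :=
        hf (M.vertex d, .outer)
      rw [Equiv.symm_apply_apply] at h2
      exact s.symm (s.trans (s.trans h1 (hio _)) (s.trans h2 (s.symm (hio _))))
    have key2 : ∀ x, s x (x.1, .inner) := by
      rintro ⟨d, _ | _⟩
      · exact s.refl _
      · exact s.symm (hio d)
    exact fun x y => s.trans (key2 x) (s.trans (key _ _) (s.symm (key2 y)))
  · intro d
    rw [hv]
    norm_num
  · rintro ⟨d, _ | _⟩ hd
    · refine ⟨?_, fun h => nomatch h⟩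
      rw [← h.face_period d]
      exact Function.minimalPeriod_of_semiconj (ι := fun d => (d, RectKind.inner)) (fun _ => rfl)
        (Prod.mk_left_injective _) d
    · exact nomatch hd
  · rintro ⟨d, _ | _⟩ hd
    · exact absurd rfl hd
    · refine ⟨Subsingleton.elim _ _, iff_of_true rfl rfl, ?_⟩
      rw [Function.iterate_one, ← h.vertex_symm_period d]
      exact Function.minimalPeriod_of_semiconj (ι := fun d => (d, RectKind.outer)) (fun _ => rfl)
        (Prod.mk_left_injective _) d
  · exact (ncard_kind D RectKind.inner).trans (h.card.trans hb)
  · refine (ncard_kind_compl D RectKind.inner (r := 1)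
      (Nat.card_eq_of_equiv_fin RectKind.equivFin)).trans ?_
    rw [h.card, hw]
    ring
  · refine card_vertex four_pos hv ?_
    rw [Nat.card_prod, h.card, Nat.card_eq_of_equiv_fin RectKind.equivFin]
    omega
  · rw [← hb, mul_one, ← hw]
    omega

/-- There is one trivalent vertex for each old dart. Along a white face `cut` and `side` alternate,
and two steps amount to `M.face`. -/
theorem truncate (h : M.IsRegular p q N) (hp : 0 < p) (hq : 0 < q) (hb : N = q * b)
    (hw : N = p * w) (he : 2 * b + 2 * w = N + 4) :
    M.truncate.IsFootballPattern q (p * 2) 2 ∧ M.truncate.numBlack = b ∧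
      M.truncate.numWhite = w := by
  have := h.finite
  have hv : ∀ d, Function.minimalPeriod M.truncate.toCombMap.vertex d = 3 := by
    rintro ⟨d, _ | _ | _⟩
    · refine minimalPeriod_vertex_three (fun hd => nomatch congrArg Prod.snd hd) ?_
      change (M.vertex (M.vertex.symm d), TruncKind.cut) = _
      simp
    · refine minimalPeriod_vertex_three (fun hd => nomatch congrArg Prod.snd hd) ?_
      change (M.vertex.symm (M.vertex d), TruncKind.side) = _
      simp
    · refine minimalPeriod_vertex_three (fun hd => nomatch congrArg Prod.snd hd) ?_
      change (M.vertex.symm (M.vertex d), TruncKind.rim) = _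
      simp
  refine PaintedMap.isFootballPattern_of_phase (v := N) hq hp
    (fun x => match x.2 with | .cut => 0 | .side => 1 | .rim => 0) ?_ ?_ ?_ ?_ ?_ ?_ ?_ ?_
  · intro s hf he
    have key2 : ∀ x, s x (x.1, .side) := by
      rintro ⟨d, _ | _ | _⟩
      · exact hf (d, .cut)
      · exact s.refl _
      · exact s.trans (he (d, .rim)) (hf (d, .cut))
    have key : ∀ a b, s (a, .side) (b, .side) :=
      h.connected (s.comap fun d => (d, TruncKind.side))
        (fun d => s.trans (hf (d, .side)) (hf (M.face d, .cut))) (fun d => he (d, .side))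
    exact fun x y => s.trans (key2 x) (s.trans (key _ _) (s.symm (key2 y)))
  · intro d
    rw [hv]
  · rintro ⟨d, _ | _ | _⟩ hd
    · exact nomatch hd
    · exact nomatch hd
    · refine ⟨?_, fun h => nomatch h⟩
      rw [← h.vertex_symm_period d]
      exact Function.minimalPeriod_of_semiconj (ι := fun d => (d, TruncKind.rim)) (fun _ => rfl)
        (Prod.mk_left_injective _) d
  · rintro ⟨d, _ | _ | _⟩ hd
    · refine ⟨rfl, iff_of_true rfl rfl, ?_⟩
      rw [← h.face_period d]
      exact Function.minimalPeriod_of_semiconj (ι := fun d => (d, TruncKind.cut)) (fun _ => rfl)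
        (Prod.mk_left_injective _) d
    · refine ⟨rfl, iff_of_false (fun h => nomatch h)
        (by decide : ¬(1 : ZMod 2) = 0), ?_⟩
      rw [← h.face_period d]
      exact Function.minimalPeriod_of_semiconj (ι := fun d => (d, TruncKind.side)) (fun _ => rfl)
        (Prod.mk_left_injective _) d
    · exact absurd rfl hd
  · exact (ncard_kind D TruncKind.rim).trans (h.card.trans hb)
  · refine (ncard_kind_compl D TruncKind.rim (r := 2)
      (Nat.card_eq_of_equiv_fin TruncKind.equivFin)).trans ?_
    rw [h.card, hw]
    ring
  · refine card_vertex three_pos hv ?_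
    rw [Nat.card_prod, h.card, Nat.card_eq_of_equiv_fin TruncKind.equivFin, mul_comm]
  · rw [← hb, mul_right_comm, ← hw]
    omega

/-- Old vertices must be trivalent because they survive as vertices. Combined with Euler's formula
this gives N = 6b - 12, which is `he`. -/
theorem variation (h : M.IsRegular p 3 N) (hp : 0 < p) (hb : N = p * b)
    (hw : N = 2 * w) (he : N + 12 = 6 * b) :
    M.variation.IsFootballPattern p (2 * 3) 3 ∧ M.variation.numBlack = b ∧
      M.variation.numWhite = w := by
  have := h.finite
  have hv : ∀ d, Function.minimalPeriod M.variation.toCombMap.vertex d = 3 := by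
    rintro ⟨d, _ | _ | _ | _⟩
    · refine minimalPeriod_vertex_three (fun hd => nomatch congrArg Prod.snd hd) ?_
      change (M.face (M.face.symm d), VarKind.rim) = _
      simp
    · refine minimalPeriod_vertex_three (fun hd => nomatch congrArg Prod.snd hd) ?_
      change (M.face.symm (M.face d), VarKind.base) = _
      simp
    · refine minimalPeriod_vertex_three (fun hd => nomatch congrArg Prod.snd hd) ?_
      change (M.face (M.face.symm d), VarKind.out) = _
      simp
    · rw [← h.vertex_period d]
      exact Function.minimalPeriod_of_semiconj (ι := fun d => (d, VarKind.inn)) (fun _ => rfl)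
        (Prod.mk_left_injective _) d
  -- Three steps around a white hexagon amount to `M.edge` on the kinds `base` and `out`, and to a
  -- conjugate of it on `inn`: an involution without fixed points.
  have htwo : ∀ {x : D × VarKind}, M.variation.face^[3] (M.variation.face^[3] x) = x →
      M.variation.face^[3] x ≠ x → Function.minimalPeriod M.variation.face^[3] x = 2 :=
    fun h1 h2 => Function.minimalPeriod_eq_prime (hp := ⟨Nat.prime_two⟩) h1 h2
  have hsv : ∀ d, M.face.symm (M.vertex d) = M.edge d := fun d => by
    rw [vertex_apply, Equiv.symm_apply_apply]
  -- All vertices are trivalent, so there are 4N/3 of them, and N/3 = 2b - 4.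
  refine PaintedMap.isFootballPattern_of_phase (v := 4 * (2 * b - 4)) hp two_pos
    (fun x => match x.2 with | .base => 0 | .out => 1 | .inn => 2 | .rim => 0) ?_ ?_ ?_ ?_ ?_ ?_
    ?_ ?_
  · intro s hf he
    have key2 : ∀ x, s x (x.1, .base) := by
      rintro ⟨d, _ | _ | _ | _⟩
      · exact he (d, .rim)
      · exact s.refl _
      · exact s.symm (hf (d, .base))
      · exact s.trans (he (d, .inn)) (s.symm (hf (d, .base)))
    have hface : ∀ d, s (d, .base) (M.face d, .base) := fun d =>
      s.trans (he (d, .base)) (s.trans (hf (d, .rim)) (he (M.face d, .rim)))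
    have hvertex : ∀ d, s (d, .base) (M.vertex d, .base) := fun d =>
      s.trans (hf (d, .base)) (s.trans (hf (d, .out)) (key2 (M.vertex d, .inn)))
    have key : ∀ a b, s (a, .base) (b, .base) :=
      h.connected (s.comap fun d => (d, VarKind.base)) hface
        (fun d => s.trans (hvertex d) (s.symm (hface (M.edge d))))
    exact fun x y => s.trans (key2 x) (s.trans (key _ _) (s.symm (key2 y)))
  · intro d
    rw [hv]
  · rintro ⟨d, _ | _ | _ | _⟩ hd
    · refine ⟨?_, fun h => nomatch h⟩
      rw [← h.face_period d]
      exact Function.minimalPeriod_of_semiconj (ι := fun d => (d, VarKind.rim)) (fun _ => rfl)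
        (Prod.mk_left_injective _) d
    · exact nomatch hd
    · exact nomatch hd
    · exact nomatch hd
  · rintro ⟨d, _ | _ | _ | _⟩ hd
    · exact absurd rfl hd
    · refine ⟨rfl, iff_of_true rfl rfl, htwo ?_ fun h1 => ?_⟩
      · change (M.face.symm (M.vertex (M.face.symm (M.vertex d))), VarKind.base) = _
        rw [hsv, hsv, M.edge_edge]
      · have h2 : M.face.symm (M.vertex d) = d := congrArg Prod.fst h1
        rw [hsv] at h2
        exact M.edge_ne _ h2
    · refine ⟨rfl, iff_of_false (fun h => nomatch h)
        (by decide : ¬(1 : ZMod 3) = 0), htwo ?_ fun h1 => ?_⟩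
      · change (M.face.symm (M.vertex (M.face.symm (M.vertex d))), VarKind.out) = _
        rw [hsv, hsv, M.edge_edge]
      · have h2 : M.face.symm (M.vertex d) = d := congrArg Prod.fst h1
        rw [hsv] at h2
        exact M.edge_ne _ h2
    · refine ⟨rfl, iff_of_false (fun h => nomatch h)
        (by decide : ¬(2 : ZMod 3) = 0), htwo ?_ fun h1 => ?_⟩
      · change (M.vertex (M.face.symm (M.vertex (M.face.symm d))), VarKind.inn) = _
        rw [hsv, vertex_edge, Equiv.apply_symm_apply]
      · have h2 : M.face (M.edge (M.face.symm d)) = d := congrArg Prod.fst h1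
        rw [← Equiv.eq_symm_apply] at h2
        exact M.edge_ne _ h2
  · exact (ncard_kind D VarKind.rim).trans (h.card.trans hb)
  · refine (ncard_kind_compl D VarKind.rim (r := 3)
      (Nat.card_eq_of_equiv_fin VarKind.equivFin)).trans ?_
    rw [h.card, hw]
    ring
  · refine card_vertex three_pos hv ?_
    rw [Nat.card_prod, h.card, Nat.card_eq_of_equiv_fin VarKind.equivFin]
    omega
  · rw [← hb]
    omega

/-- Each old dart yields one hexagon with a single edge at a black face, so six steps are the
identity on white darts. The count of vertices is 7N/3, again with N/3 = 2b - 4. -/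
theorem subdivision (h : M.IsRegular p 3 N) (hp : 0 < p) (hb : N = p * b) (he : N + 12 = 6 * b) :
    M.subdivision.IsFootballPattern p (1 * 6) 6 ∧ M.subdivision.numBlack = b ∧
      M.subdivision.numWhite = N := by
  have := h.finite
  have hv : ∀ d, Function.minimalPeriod M.subdivision.toCombMap.vertex d = 3 := by
    rintro ⟨d, _ | _ | _ | _ | _ | _ | _⟩
    · refine minimalPeriod_vertex_three (fun hd => nomatch congrArg Prod.snd hd) ?_
      change (M.face (M.face.symm d), SubdivKind.rim) = _
      simp
    · refine minimalPeriod_vertex_three (fun hd => nomatch congrArg Prod.snd hd) ?_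
      change (M.face.symm (M.face d), SubdivKind.base) = _
      simp
    · refine minimalPeriod_vertex_three (fun hd => nomatch congrArg Prod.snd hd) ?_
      change (M.face (M.face.symm d), SubdivKind.out) = _
      simp
    · refine minimalPeriod_vertex_three (fun hd => nomatch congrArg Prod.snd hd) ?_
      change (M.edge (M.edge d), SubdivKind.inn) = _
      rw [M.edge_edge]
    · rw [← h.vertex_period d]
      exact Function.minimalPeriod_of_semiconj (ι := fun d => (d, SubdivKind.first))
        (fun _ => rfl) (Prod.mk_left_injective _) d
    · refine minimalPeriod_vertex_three (fun hd => nomatch congrArg Prod.snd hd) ?_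
      change (M.edge (M.edge d), SubdivKind.middle) = _
      rw [M.edge_edge]
    · refine minimalPeriod_vertex_three (fun hd => nomatch congrArg Prod.snd hd) ?_
      change (M.edge (M.edge d), SubdivKind.last) = _
      rw [M.edge_edge]
  have hone : ∀ {x : D × SubdivKind}, M.subdivision.face^[6] x = x →
      Function.minimalPeriod M.subdivision.face^[6] x = 1 :=
    fun h => Function.minimalPeriod_eq_one_iff_isFixedPt.2 h
  refine PaintedMap.isFootballPattern_of_phase (v := 7 * (2 * b - 4)) hp one_pos
    (fun x => match x.2 with
      | .base => 0 | .out => 1 | .middle => 2 | .last => 3 | .first => 4 | .inn => 5 | .rim => 0)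
    ?_ ?_ ?_ ?_ ?_ ?_ ?_ ?_
  · intro s hf he
    have hout : ∀ d, s (d, .out) (d, .middle) := fun d => hf (d, .out)
    have key2 : ∀ x, s x (x.1, .middle) := by
      rintro ⟨d, _ | _ | _ | _ | _ | _ | _⟩
      · exact s.trans (he (d, .rim)) (s.trans (hf (d, .base)) (hout d))
      · exact s.trans (hf (d, .base)) (hout d)
      · exact hout d
      · exact s.trans (he (d, .inn)) (hout d)
      · exact s.trans (hf (d, .first)) (s.trans (he (d, .inn)) (hout d))
      · exact s.refl _
      · exact s.symm (hf (d, .middle))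
    have key : ∀ a b, s (a, .middle) (b, .middle) :=
      h.connected (s.comap fun d => (d, SubdivKind.middle))
        (fun d => s.trans (s.symm (key2 (d, .rim))) (s.trans (hf (d, .rim))
          (key2 (M.face d, .rim)))) (fun d => he (d, .middle))
    exact fun x y => s.trans (key2 x) (s.trans (key _ _) (s.symm (key2 y)))
  · intro d
    rw [hv]
  · rintro ⟨d, _ | _ | _ | _ | _ | _ | _⟩ hd
    · refine ⟨?_, fun h => nomatch h⟩
      rw [← h.face_period d]
      exact Function.minimalPeriod_of_semiconj (ι := fun d => (d, SubdivKind.rim)) (fun _ => rfl)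
        (Prod.mk_left_injective _) d
    all_goals exact nomatch hd
  · rintro ⟨d, _ | _ | _ | _ | _ | _ | _⟩ hd
    · exact absurd rfl hd
    · refine ⟨rfl, iff_of_true rfl rfl, hone ?_⟩
      change (M.face.symm (M.face d), SubdivKind.base) = _
      simp
    · refine ⟨rfl, iff_of_false (fun h => nomatch h)
        (by decide : ¬(1 : ZMod 6) = 0), hone ?_⟩
      change (M.face.symm (M.face d), SubdivKind.out) = _
      simp
    · refine ⟨rfl, iff_of_false (fun h => nomatch h)
        (by decide : ¬(5 : ZMod 6) = 0), hone ?_⟩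
      change (M.face (M.face.symm d), SubdivKind.inn) = _
      simp
    · refine ⟨rfl, iff_of_false (fun h => nomatch h)
        (by decide : ¬(4 : ZMod 6) = 0), hone ?_⟩
      change (M.face (M.face.symm d), SubdivKind.first) = _
      simp
    · refine ⟨rfl, iff_of_false (fun h => nomatch h)
        (by decide : ¬(2 : ZMod 6) = 0), hone ?_⟩
      change (M.face.symm (M.face d), SubdivKind.middle) = _
      simp
    · refine ⟨rfl, iff_of_false (fun h => nomatch h)
        (by decide : ¬(3 : ZMod 6) = 0), hone ?_⟩
      change (M.face.symm (M.face d), SubdivKind.last) = _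
      simp
  · exact (ncard_kind D SubdivKind.rim).trans (h.card.trans hb)
  · refine (ncard_kind_compl D SubdivKind.rim (r := 6)
      (Nat.card_eq_of_equiv_fin SubdivKind.equivFin)).trans ?_
    rw [h.card, one_mul]
  · refine card_vertex three_pos hv ?_
    rw [Nat.card_prod, h.card, Nat.card_eq_of_equiv_fin SubdivKind.equivFin]
    omega
  · rw [← hb]
    omega

end CombMap.IsRegular

/-! ### The Platonic solids are regular. -/

/-- If `x` has order `p` and `y * x` has order `q`, then the rotation map is regular. -/
theorem rotationMap_isRegular {G : Type} [Group G] [Finite G] {x y : G} (hy : y * y = 1)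
    (hy' : y ≠ 1) (hgen : Subgroup.closure {x, y} = ⊤) {p q N : ℕ} (hp : orderOf x = p)
    (hq : orderOf (y * x) = q) (hN : Nat.card G = N) :
    (rotationMap x y hy hy').IsRegular p q N := by
  have period : ∀ (g d : G) (σ : Equiv.Perm G), (∀ a, σ a = a * g) →
      Function.minimalPeriod σ d = orderOf g := by
    intro g d σ hσ
    have key : ∀ n : ℕ, σ^[n] d = d * g ^ n := by
      intro n
      induction n with
      | zero => simp
      | succ n ih => rw [Function.iterate_succ_apply', ih, hσ, mul_assoc, pow_succ]
    refine Nat.dvd_antisymm ?_ ?_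
    · refine Function.IsPeriodicPt.minimalPeriod_dvd ?_
      rw [Function.IsPeriodicPt, Function.IsFixedPt, key, pow_orderOf_eq_one, mul_one]
    · have h := Function.iterate_minimalPeriod (f := σ) (x := d)
      rw [key, mul_eq_left] at h
      exact orderOf_dvd_of_pow_eq_one h
  refine ⟨inferInstance, hN, fun s hf he => ?_, fun d => ?_, fun d => ?_⟩
  · have key : ∀ g ∈ Subgroup.closure {x, y}, ∀ a, s a (a * g) := by
      intro g hg
      induction hg using Subgroup.closure_induction with
      | mem g hg =>
        rcases hg with rfl | rfl
        · exact hf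
        · exact he
      | one => exact fun a => by rw [mul_one]
      | mul g g' _ _ ih ih' => exact fun a => by rw [← mul_assoc]; exact s.trans (ih a) (ih' _)
      | inv g _ ih =>
        intro a
        have := ih (a * g⁻¹)
        rw [inv_mul_cancel_right] at this
        exact s.symm this
    intro a b
    have := key (a⁻¹ * b) (by rw [hgen]; trivial) a
    rwa [mul_inv_cancel_left] at this
  · rw [period x d _ (fun a => rfl), hp]
  · rw [period (y * x) d _ (fun a => mul_assoc a y x), hq]

theorem orderOf_eq_four {G : Type} [Group G] {x : G} (h2 : x * x ≠ 1) (h4 : x * x * (x * x) = 1) :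
    orderOf x = 4 := by
  refine orderOf_eq_prime_pow (p := 2) (n := 1) ?_ ?_
  · rwa [pow_one, pow_two]
  · rwa [show 2 ^ (1 + 1) = 2 + 2 from rfl, pow_add, pow_two]

theorem tetrahedron_isRegular : tetrahedron.IsRegular 3 3 12 := by
  refine rotationMap_isRegular _ _ ?_ (orderOf_eq_prime (by decide) (by decide))
    (orderOf_eq_prime (by decide) (by decide)) ?_
  · set x : alternatingGroup (Fin 4) :=
      ⟨Equiv.swap 0 1 * Equiv.swap 1 2, Equiv.Perm.mem_alternatingGroup.mpr (by decide)⟩ with hx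
    set y : alternatingGroup (Fin 4) :=
      ⟨Equiv.swap 0 1 * Equiv.swap 2 3, Equiv.Perm.mem_alternatingGroup.mpr (by decide)⟩ with hy
    rw [eq_top_iff]
    intro g _
    -- The group of order 12 is the union of two double cosets of the subgroup generated by `x`, of
    -- sizes 3 and 9.
    have key : ∀ g : alternatingGroup (Fin 4),
        ∃ i j : Fin 3, ∃ k : Fin 2, g = x ^ (i : ℕ) * y ^ (k : ℕ) * x ^ (j : ℕ) := by
      decide
    obtain ⟨i, j, k, rfl⟩ := key g
    have h1 : x ∈ Subgroup.closure {x, y} := Subgroup.subset_closure (by simp)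
    have h2 : y ∈ Subgroup.closure {x, y} := Subgroup.subset_closure (by simp)
    exact mul_mem (mul_mem (pow_mem h1 _) (pow_mem h2 _)) (pow_mem h1 _)
  · rw [Nat.card_eq_fintype_card]
    decide

theorem cube_isRegular : cube.IsRegular 4 3 24 := by
  refine rotationMap_isRegular _ _ ?_ (orderOf_eq_four (by decide) (by decide))
    (orderOf_eq_prime (by decide) (by decide)) ?_
  · exact closure_cycle_adjacent_swap isCycle_finRotate support_finRotate 0
  · rw [Nat.card_eq_fintype_card, Fintype.card_perm, Fintype.card_fin]
    rfl

/-- Generation follows from Lagrange and simplicity: the generated subgroup contains elements of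
orders 5, 2 and 3, so its index divides 2, and index two would make it a proper nontrivial normal
subgroup. -/
theorem dodecahedron_isRegular : dodecahedron.IsRegular 5 3 60 := by
  have : Fact (Nat.Prime 5) := ⟨Nat.prime_five⟩
  have hcard : Nat.card (alternatingGroup (Fin 5)) = 60 := by
    rw [nat_card_alternatingGroup, Nat.card_eq_fintype_card, Fintype.card_fin]
    rfl
  have hx : orderOf (⟨finRotate 5, Equiv.Perm.mem_alternatingGroup.mpr (by decide)⟩ :
    alternatingGroup (Fin 5)) = 5 := orderOf_eq_prime (by decide) (by decide)
  refine rotationMap_isRegular _ _ ?_ hx (orderOf_eq_prime (by decide) (by decide)) hcard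
  set x : alternatingGroup (Fin 5) :=
    ⟨finRotate 5, Equiv.Perm.mem_alternatingGroup.mpr (by decide)⟩
  set y : alternatingGroup (Fin 5) :=
    ⟨Equiv.swap 0 1 * Equiv.swap 2 3, Equiv.Perm.mem_alternatingGroup.mpr (by decide)⟩
  have h1 : x ∈ Subgroup.closure {x, y} := Subgroup.subset_closure (by simp)
  have h2 : y ∈ Subgroup.closure {x, y} := Subgroup.subset_closure (by simp)
  have hy : orderOf y = 2 := orderOf_eq_prime (by decide) (by decide)
  have hyx : orderOf (y * x) = 3 := orderOf_eq_prime (by decide) (by decide)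
  set H := Subgroup.closure {x, y}
  have d5 := Subgroup.orderOf_dvd_natCard H h1
  have d2 := Subgroup.orderOf_dvd_natCard H h2
  have d3 := Subgroup.orderOf_dvd_natCard H (mul_mem h2 h1)
  have hH := H.card_mul_index
  rw [hx] at d5
  rw [hy] at d2
  rw [hyx] at d3
  rw [hcard] at hH
  have hidx : H.index = 1 ∨ H.index = 2 := by
    obtain ⟨c, hc⟩ : 30 ∣ Nat.card H := by omega
    rw [hc, mul_assoc] at hH
    have h3 : c * H.index = 2 := by omega
    have h4 : H.index ∣ 2 := ⟨c, by rw [← h3, mul_comm]⟩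
    exact (Nat.dvd_prime Nat.prime_two).1 h4
  rcases hidx with h | h
  · exact Subgroup.index_eq_one.1 h
  · have hn := Subgroup.normal_of_index_eq_two h
    rcases hn.eq_bot_or_eq_top with hb | ht
    · rw [hb, Subgroup.index_bot, hcard] at h
      omega
    · exact ht

theorem octahedron_isRegular : octahedron.IsRegular 3 4 24 := cube_isRegular.dual

theorem icosahedron_isRegular : icosahedron.IsRegular 3 5 60 := dodecahedron_isRegular.dual

/-! ### Models for the infinite sequences. -/

theorem ZMod.setoid_of_add_one {k : ℕ} (hk : 0 < k) (s : Setoid (ZMod k))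
    (h : ∀ i, s i (i + 1)) : ∀ i j, s i j := by
  have : NeZero k := ⟨hk.ne'⟩
  have key : ∀ n : ℕ, s 0 (n : ZMod k) := by
    intro n
    induction n with
    | zero => simp
    | succ n ih =>
      rw [Nat.cast_succ]
      exact s.trans ih (h _)
  intro i j
  have hi := key i.val
  have hj := key j.val
  rw [ZMod.natCast_zmod_val] at hi hj
  exact s.trans (s.symm hi) hj

theorem ZMod.minimalPeriod_add_one (k : ℕ) (i : ZMod k) :
    Function.minimalPeriod (fun i : ZMod k => i + 1) i = k := by
  have key : ∀ n : ℕ, (fun i : ZMod k => i + 1)^[n] i = i + n := by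
    intro n
    induction n with
    | zero => simp
    | succ n ih => rw [Function.iterate_succ_apply', ih, Nat.cast_succ, add_assoc]
  refine Nat.dvd_antisymm (Function.IsPeriodicPt.minimalPeriod_dvd ?_) ?_
  · rw [Function.IsPeriodicPt, Function.IsFixedPt, key, ZMod.natCast_self, add_zero]
  · have h := Function.iterate_minimalPeriod (f := fun i : ZMod k => i + 1) (x := i)
    rwa [key, add_eq_left, ZMod.natCast_eq_zero_iff] at h

theorem ZMod.minimalPeriod_sub_one (k : ℕ) (i : ZMod k) :
    Function.minimalPeriod (fun i : ZMod k => i - 1) i = k := by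
  have h : (fun i : ZMod k => i - 1) = (Equiv.addRight (1 : ZMod k)).symm := by
    ext j
    simp [sub_eq_add_neg]
  rw [h, Equiv.Perm.minimalPeriod_symm]
  exact ZMod.minimalPeriod_add_one k i

/-- The faces are digons and the poles have valence `k`, so the general result on truncation
applies. -/
theorem americanFootball_isRegular {k : ℕ} (hk : 3 ≤ k) :
    (americanFootball k).IsRegular 2 k (2 * k) := by
  have : NeZero k := ⟨by omega⟩
  refine ⟨inferInstance, ?_, fun s hf he => ?_, ?_, ?_⟩
  · rw [Nat.card_prod, Nat.card_zmod, Nat.card_eq_fintype_card, Fintype.card_bool, mul_comm]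
  · have key2 : ∀ x, s x (x.1, true) := by
      rintro ⟨i, _ | _⟩
      · exact he (i, false)
      · exact s.refl _
    have key := ZMod.setoid_of_add_one (by omega) (s.comap fun i => (i, true))
      fun i => s.trans (hf (i, true)) (key2 (i + 1, false))
    exact fun x y => s.trans (key2 x) (s.trans (key _ _) (s.symm (key2 y)))
  · rintro ⟨i, _ | _⟩
    · refine Function.minimalPeriod_eq_prime (hp := ⟨Nat.prime_two⟩) ?_
        (fun h => nomatch congrArg Prod.snd h)
      change (i - 1 + 1, false) = _
      rw [sub_add_cancel]
    · refine Function.minimalPeriod_eq_prime (hp := ⟨Nat.prime_two⟩) ?_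
        (fun h => nomatch congrArg Prod.snd h)
      change (i + 1 - 1, true) = _
      rw [add_sub_cancel_right]
  · rintro ⟨i, _ | _⟩
    · refine (Function.minimalPeriod_of_semiconj (ι := fun i => (i, false)) (fun _ => rfl)
        (Prod.mk_left_injective _) i).trans (ZMod.minimalPeriod_add_one k i)
    · refine (Function.minimalPeriod_of_semiconj (ι := fun i => (i, true)) (fun _ => rfl)
        (Prod.mk_left_injective _) i).trans (ZMod.minimalPeriod_sub_one k i)

/-- The remaining pole has valence `k` and all other vertices have valence three, so the two sorts
of vertices are counted separately. -/
theorem partiallyTruncatedAmericanFootball_pattern {k : ℕ} (hk : 3 ≤ k) :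
    (partiallyTruncatedAmericanFootball k).IsFootballPattern k (1 * 3) 3 ∧
      (partiallyTruncatedAmericanFootball k).numBlack = 1 ∧
      (partiallyTruncatedAmericanFootball k).numWhite = k := by
  have : NeZero k := ⟨by omega⟩
  set P := partiallyTruncatedAmericanFootball k with hP
  have hpole : ∀ i, Function.minimalPeriod P.toCombMap.vertex (i, .inn) = k := fun i =>
    (Function.minimalPeriod_of_semiconj (ι := fun i => (i, PartKind.inn)) (fun _ => rfl)
      (Prod.mk_left_injective _) i).trans (ZMod.minimalPeriod_add_one k i)
  have hrim : ∀ x : ZMod k × PartKind, x.2 ≠ .inn →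
      Function.minimalPeriod P.toCombMap.vertex x = 3 := by
    rintro ⟨i, _ | _ | _ | _⟩ hx
    · refine CombMap.minimalPeriod_vertex_three (fun hd => nomatch congrArg Prod.snd hd) ?_
      change (i - 1 + 1, PartKind.rim) = _
      rw [sub_add_cancel]
    · refine CombMap.minimalPeriod_vertex_three (fun hd => nomatch congrArg Prod.snd hd) ?_
      change (i + 1 - 1, PartKind.base) = _
      rw [add_sub_cancel_right]
    · refine CombMap.minimalPeriod_vertex_three (fun hd => nomatch congrArg Prod.snd hd) ?_
      change (i - 1 + 1, PartKind.out) = _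
      rw [sub_add_cancel]
    · exact absurd rfl hx
  have hone : ∀ {x : ZMod k × PartKind}, P.face^[3] x = x →
      Function.minimalPeriod P.face^[3] x = 1 :=
    fun h => Function.minimalPeriod_eq_one_iff_isFixedPt.2 h
  refine PaintedMap.isFootballPattern_of_phase (v := 1 + k) (by omega) one_pos
    (fun x => match x.2 with | .base => 0 | .out => 1 | .inn => 2 | .rim => 0) ?_ ?_ ?_ ?_ ?_ ?_
    ?_ ?_
  · intro s hf he
    have key2 : ∀ x, s x (x.1, .base) := by
      rintro ⟨d, _ | _ | _ | _⟩
      · exact he (d, .rim)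
      · exact s.refl _
      · exact s.symm (hf (d, .base))
      · exact s.trans (he (d, .inn)) (s.symm (hf (d, .base)))
    have key := ZMod.setoid_of_add_one (by omega) (s.comap fun i => (i, PartKind.base)) fun d =>
      s.trans (he (d, .base)) (s.trans (hf (d, .rim)) (he (d + 1, .rim)))
    exact fun x y => s.trans (key2 x) (s.trans (key _ _) (s.symm (key2 y)))
  · rintro ⟨i, x⟩
    by_cases hx : x = .inn
    · rw [hx, hpole]
      exact hk
    · rw [hrim _ hx]
  · rintro ⟨i, _ | _ | _ | _⟩ hd
    · exact ⟨(Function.minimalPeriod_of_semiconj (ι := fun i => (i, PartKind.rim)) (fun _ => rfl)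
        (Prod.mk_left_injective _) i).trans (ZMod.minimalPeriod_add_one k i), fun h => nomatch h⟩
    all_goals exact nomatch hd
  · rintro ⟨d, _ | _ | _ | _⟩ hd
    · exact absurd rfl hd
    · refine ⟨rfl, iff_of_true rfl rfl, hone ?_⟩
      change (d + 1 - 1, PartKind.base) = _
      rw [add_sub_cancel_right]
    · refine ⟨rfl, iff_of_false (fun h => nomatch h) (by decide : ¬(1 : ZMod 3) = 0), hone ?_⟩
      change (d + 1 - 1, PartKind.out) = _
      rw [add_sub_cancel_right]
    · refine ⟨rfl, iff_of_false (fun h => nomatch h) (by decide : ¬(2 : ZMod 3) = 0), hone ?_⟩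
      change (d - 1 + 1, PartKind.inn) = _
      rw [sub_add_cancel]
  · refine (ncard_kind (ZMod k) PartKind.rim).trans ?_
    rw [Nat.card_zmod, mul_one]
  · refine (ncard_kind_compl (ZMod k) PartKind.rim (r := 3)
      (Nat.card_eq_of_equiv_fin PartKind.equivFin)).trans ?_
    rw [Nat.card_zmod, one_mul]
  -- The darts leaving the pole are exactly those of kind `inn`; they form one cycle, and the other
  -- 3k darts form k cycles of length three.
  · have hS : ∀ d, P.toCombMap.vertex d ∈ {p : ZMod k × PartKind | p.2 = .inn} ↔
        d ∈ {p : ZMod k × PartKind | p.2 = .inn} := by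
      rintro ⟨d, _ | _ | _ | _⟩
      · exact iff_of_false (fun h => nomatch h) (fun h => nomatch h)
      · exact iff_of_false (fun h => nomatch h) (fun h => nomatch h)
      · exact iff_of_false (fun h => nomatch h) (fun h => nomatch h)
      · exact iff_of_true rfl rfl
    have h1 := ncard_eq_mul_ncard_image _ hS (q := k) (by rintro ⟨i, _⟩ rfl; exact hpole i)
    have h2 := ncard_eq_mul_ncard_image _ (fun d => not_congr (hS d)) (q := 3)
      (fun x hx => hrim x hx)
    rw [ncard_kind, Nat.card_zmod, left_eq_mul₀ (by omega)] at h1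
    have h3 := ncard_kind_compl (ZMod k) PartKind.inn (r := 3)
      (Nat.card_eq_of_equiv_fin PartKind.equivFin)
    rw [Nat.card_zmod] at h3
    have h4 := card_cycles_eq _ hS
    have h5 := h3.symm.trans h2
    refine h4.trans ?_
    rw [h1]
    exact congrArg _ (Nat.eq_of_mul_eq_mul_left three_pos h5.symm)
  · ring

/-- Connectedness of maps made of two halves. -/
theorem setoid_halves {k : ℕ} (hk : 0 < k) (s : Setoid (ZMod k × Bool))
    (h1 : ∀ i b, s (i, b) (i + 1, b)) (h2 : ∀ i, s (i, true) (-i, false)) : ∀ x y, s x y := by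
  have key := ZMod.setoid_of_add_one hk (s.comap fun i => (i, true)) fun i => h1 i true
  -- The halves are glued with reversed orientation, so an index on the second half corresponds to
  -- its negative on the first.
  have key2 : ∀ x, s x (if x.2 then x.1 else -x.1, true) := by
    rintro ⟨i, _ | _⟩
    · have := h2 (-i)
      rw [neg_neg] at this
      exact s.symm this
    · exact s.refl _
  exact fun x y => s.trans (key2 x) (s.trans (key _ _) (s.symm (key2 y)))

theorem card_halves (k : ℕ) [NeZero k] : Nat.card (ZMod k × Bool) = 2 * k := by
  rw [Nat.card_prod, Nat.card_zmod, Nat.card_eq_fintype_card, Fintype.card_bool, mul_comm]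

theorem minimalPeriod_halves {k : ℕ} (i : ZMod k) (b : Bool) :
    Function.minimalPeriod (fun p : ZMod k × Bool => (p.1 + 1, p.2)) (i, b) = k :=
  (Function.minimalPeriod_of_semiconj (ι := fun i => (i, b)) (fun _ => rfl)
    (Prod.mk_left_injective _) i).trans (ZMod.minimalPeriod_add_one k i)

/-- At an equatorial vertex the kinds `inn` and `equator` alternate, giving k vertices of valence
four; the remaining 6k darts give 2k trivalent ones. -/
theorem doubleTinCan_pattern {k : ℕ} (hk : 3 ≤ k) :
    (doubleTinCan k).IsFootballPattern k (1 * 4) 4 ∧ (doubleTinCan k).numBlack = 2 ∧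
      (doubleTinCan k).numWhite = 2 * k := by
  have : NeZero k := ⟨by omega⟩
  set P := doubleTinCan k with hP
  have hrim : ∀ x ∈ {p : (ZMod k × Bool) × TinKind | p.2 = .inn ∨ p.2 = .equator}ᶜ,
      Function.minimalPeriod P.toCombMap.vertex x = 3 := by
    rintro ⟨⟨i, b⟩, _ | _ | _ | _ | _⟩ hx
    · refine CombMap.minimalPeriod_vertex_three (fun hd => nomatch congrArg Prod.snd hd) ?_
      change ((i - 1 + 1, b), TinKind.rim) = _
      rw [sub_add_cancel]
    · refine CombMap.minimalPeriod_vertex_three (fun hd => nomatch congrArg Prod.snd hd) ?_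
      change ((i + 1 - 1, b), TinKind.base) = _
      rw [add_sub_cancel_right]
    · refine CombMap.minimalPeriod_vertex_three (fun hd => nomatch congrArg Prod.snd hd) ?_
      change ((i - 1 + 1, b), TinKind.out) = _
      rw [sub_add_cancel]
    · exact absurd (Or.inl rfl) hx
    · exact absurd (Or.inr rfl) hx
  have heq : ∀ x ∈ {p : (ZMod k × Bool) × TinKind | p.2 = .inn ∨ p.2 = .equator},
      Function.minimalPeriod P.toCombMap.vertex x = 4 := by
    rintro ⟨⟨i, b⟩, _ | _ | _ | _ | _⟩ hx
    · rcases hx with hx | hx <;> exact nomatch hx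
    · rcases hx with hx | hx <;> exact nomatch hx
    · rcases hx with hx | hx <;> exact nomatch hx
    · refine CombMap.minimalPeriod_vertex_four (fun hd => ?_) ?_
      · have h2 : (!b) = b := congrArg (fun p => p.1.2) hd
        cases b <;> exact nomatch h2
      · change ((-(-i + 1) + 1, !!b), TinKind.inn) = _
        simp
    · refine CombMap.minimalPeriod_vertex_four (fun hd => ?_) ?_
      · have h2 : (!b) = b := congrArg (fun p => p.1.2) hd
        cases b <;> exact nomatch h2
      · change ((-(-i + 1) + 1, !!b), TinKind.equator) = _
        simp
  have hone : ∀ {x : (ZMod k × Bool) × TinKind}, P.face^[4] x = x →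
      Function.minimalPeriod P.face^[4] x = 1 :=
    fun h => Function.minimalPeriod_eq_one_iff_isFixedPt.2 h
  have hkind := ncard_kind_compl (ZMod k × Bool) TinKind.rim (r := 4)
      (Nat.card_eq_of_equiv_fin TinKind.equivFin)
  refine PaintedMap.isFootballPattern_of_phase (v := k + 2 * k) (by omega) one_pos
    (fun x => match x.2 with | .base => 0 | .out => 1 | .equator => 2 | .inn => 3 | .rim => 0)
    ?_ ?_ ?_ ?_ ?_ ?_ ?_ ?_
  · intro s hf he
    have key2 : ∀ x, s x (x.1, .out) := by
      rintro ⟨d, _ | _ | _ | _ | _⟩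
      · exact s.trans (he (d, .rim)) (hf (d, .base))
      · exact hf (d, .base)
      · exact s.refl _
      · exact he (d, .inn)
      · exact s.symm (hf (d, .out))
    have key := setoid_halves (by omega) (s.comap fun d => (d, TinKind.out))
      (fun i b => s.trans (s.symm (key2 ((i, b), .rim))) (s.trans (hf ((i, b), .rim))
        (key2 ((i + 1, b), .rim))))
      (fun i => s.trans (hf ((i, true), .out)) (s.trans (he ((i, true), .equator))
        (key2 ((-i, false), .equator))))
    exact fun x y => s.trans (key2 x) (s.trans (key _ _) (s.symm (key2 y)))
  · intro x
    by_cases hx : x ∈ {p : (ZMod k × Bool) × TinKind | p.2 = .inn ∨ p.2 = .equator}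
    · rw [heq x hx]
      norm_num
    · rw [hrim x hx]
  · rintro ⟨⟨i, b⟩, _ | _ | _ | _ | _⟩ hd
    · exact ⟨(Function.minimalPeriod_of_semiconj (ι := fun i => (i, TinKind.rim)) (fun _ => rfl)
        (Prod.mk_left_injective _) _).trans (minimalPeriod_halves i b), fun h => nomatch h⟩
    all_goals exact nomatch hd
  · rintro ⟨⟨i, b⟩, _ | _ | _ | _ | _⟩ hd
    · exact absurd rfl hd
    · refine ⟨rfl, iff_of_true rfl rfl, hone ?_⟩
      change ((i + 1 - 1, b), TinKind.base) = _
      rw [add_sub_cancel_right]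
    · refine ⟨rfl, iff_of_false (fun h => nomatch h) (by decide : ¬(1 : ZMod 4) = 0), hone ?_⟩
      change ((i + 1 - 1, b), TinKind.out) = _
      rw [add_sub_cancel_right]
    · refine ⟨rfl, iff_of_false (fun h => nomatch h) (by decide : ¬(3 : ZMod 4) = 0), hone ?_⟩
      change ((i - 1 + 1, b), TinKind.inn) = _
      rw [sub_add_cancel]
    · refine ⟨rfl, iff_of_false (fun h => nomatch h) (by decide : ¬(2 : ZMod 4) = 0), hone ?_⟩
      change ((i + 1 - 1, b), TinKind.equator) = _
      rw [add_sub_cancel_right]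
  · refine (ncard_kind (ZMod k × Bool) TinKind.rim).trans ?_
    rw [card_halves, mul_comm]
  · refine hkind.trans ?_
    rw [card_halves, one_mul]
  · have hS : ∀ d, P.toCombMap.vertex d ∈
          {p : (ZMod k × Bool) × TinKind | p.2 = .inn ∨ p.2 = .equator} ↔
        d ∈ {p : (ZMod k × Bool) × TinKind | p.2 = .inn ∨ p.2 = .equator} := by
      rintro ⟨⟨i, b⟩, _ | _ | _ | _ | _⟩
      · exact iff_of_false (fun h => by rcases h with h | h <;> exact nomatch h)
          (fun h => by rcases h with h | h <;> exact nomatch h)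
      · exact iff_of_false (fun h => by rcases h with h | h <;> exact nomatch h)
          (fun h => by rcases h with h | h <;> exact nomatch h)
      · exact iff_of_false (fun h => by rcases h with h | h <;> exact nomatch h)
          (fun h => by rcases h with h | h <;> exact nomatch h)
      · exact iff_of_true (Or.inr rfl) (Or.inl rfl)
      · exact iff_of_true (Or.inl rfl) (Or.inr rfl)
    have h1 := ncard_eq_mul_ncard_image _ hS heq
    have h2 := ncard_eq_mul_ncard_image _ (fun d => not_congr (hS d)) hrim
    have h3 : {p : (ZMod k × Bool) × TinKind | p.2 = .inn ∨ p.2 = .equator}.ncard =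
        2 * k + 2 * k := by
      rw [Set.ofPred_or, Set.ncard_union_eq, ncard_kind, ncard_kind, card_halves]
      rw [Set.disjoint_left]
      rintro ⟨i, _⟩ rfl h
      exact nomatch h
    have h4 := Set.ncard_add_ncard_compl
      {p : (ZMod k × Bool) × TinKind | p.2 = .inn ∨ p.2 = .equator}
    rw [Nat.card_prod, card_halves, Nat.card_eq_of_equiv_fin TinKind.equivFin] at h4
    have h5 := card_cycles_eq _ hS
    have h6 := h3.symm.trans h1
    have h7 : 3 * (2 * k) = _ := Eq.trans (by omega) h2
    refine h5.trans (congrArg₂ _ ?_ (Nat.eq_of_mul_eq_mul_left three_pos h7.symm))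
    exact Nat.eq_of_mul_eq_mul_left four_pos (h6.symm.trans (by ring))
  · ring

theorem zigzagTinCan_pattern {k : ℕ} (hk : 3 ≤ k) :
    (zigzagTinCan k).IsFootballPattern k (1 * 5) 5 ∧ (zigzagTinCan k).numBlack = 2 ∧
      (zigzagTinCan k).numWhite = 2 * k := by
  have : NeZero k := ⟨by omega⟩
  set P := zigzagTinCan k with hP
  have hv : ∀ x, Function.minimalPeriod P.toCombMap.vertex x = 3 := by
    rintro ⟨⟨i, b⟩, _ | _ | _ | _ | _ | _⟩
    · refine CombMap.minimalPeriod_vertex_three (fun hd => nomatch congrArg Prod.snd hd) ?_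
      change ((i - 1 + 1, b), ZigzagKind.rim) = _
      rw [sub_add_cancel]
    · refine CombMap.minimalPeriod_vertex_three (fun hd => nomatch congrArg Prod.snd hd) ?_
      change ((i + 1 - 1, b), ZigzagKind.base) = _
      rw [add_sub_cancel_right]
    · refine CombMap.minimalPeriod_vertex_three (fun hd => nomatch congrArg Prod.snd hd) ?_
      change ((i - 1 + 1, b), ZigzagKind.out) = _
      rw [sub_add_cancel]
    · refine CombMap.minimalPeriod_vertex_three (fun hd => nomatch congrArg Prod.snd hd) ?_
      change ((- -i - 1 + 1, !!b), ZigzagKind.inn) = _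
      simp
    · refine CombMap.minimalPeriod_vertex_three (fun hd => nomatch congrArg Prod.snd hd) ?_
      change ((-(-i) - 1 + 1, !!b), ZigzagKind.zig) = _
      simp
    · refine CombMap.minimalPeriod_vertex_three (fun hd => nomatch congrArg Prod.snd hd) ?_
      change ((-(-i - 1 + 1), !!b), ZigzagKind.zag) = _
      simp
  have hone : ∀ {x : (ZMod k × Bool) × ZigzagKind}, P.face^[5] x = x →
      Function.minimalPeriod P.face^[5] x = 1 :=
    fun h => Function.minimalPeriod_eq_one_iff_isFixedPt.2 h
  refine PaintedMap.isFootballPattern_of_phase (v := 4 * k) (by omega) one_pos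
    (fun x => match x.2 with
      | .base => 0 | .out => 1 | .zig => 2 | .zag => 3 | .inn => 4 | .rim => 0)
    ?_ ?_ ?_ ?_ ?_ ?_ ?_ ?_
  · intro s hf he
    have key2 : ∀ x, s x (x.1, .out) := by
      rintro ⟨d, _ | _ | _ | _ | _ | _⟩
      · exact s.trans (he (d, .rim)) (hf (d, .base))
      · exact hf (d, .base)
      · exact s.refl _
      · exact he (d, .inn)
      · exact s.symm (hf (d, .out))
      · exact s.symm (s.trans (hf (d, .out)) (hf (d, .zig)))
    have key := setoid_halves (by omega) (s.comap fun d => (d, ZigzagKind.out))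
      (fun i b => s.trans (s.symm (key2 ((i, b), .rim))) (s.trans (hf ((i, b), .rim))
        (key2 ((i + 1, b), .rim))))
      (fun i => s.trans (hf ((i, true), .out)) (s.trans (he ((i, true), .zig))
        (key2 ((-i, false), .zig))))
    exact fun x y => s.trans (key2 x) (s.trans (key _ _) (s.symm (key2 y)))
  · intro x
    rw [hv]
  · rintro ⟨⟨i, b⟩, _ | _ | _ | _ | _ | _⟩ hd
    · exact ⟨(Function.minimalPeriod_of_semiconj (ι := fun i => (i, ZigzagKind.rim))
        (fun _ => rfl) (Prod.mk_left_injective _) _).trans (minimalPeriod_halves i b),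
        fun h => nomatch h⟩
    all_goals exact nomatch hd
  · rintro ⟨⟨i, b⟩, _ | _ | _ | _ | _ | _⟩ hd
    · exact absurd rfl hd
    · refine ⟨rfl, iff_of_true rfl rfl, hone ?_⟩
      change ((i + 1 - 1, b), ZigzagKind.base) = _
      rw [add_sub_cancel_right]
    · refine ⟨rfl, iff_of_false (fun h => nomatch h) (by decide : ¬(1 : ZMod 5) = 0), hone ?_⟩
      change ((i + 1 - 1, b), ZigzagKind.out) = _
      rw [add_sub_cancel_right]
    · refine ⟨rfl, iff_of_false (fun h => nomatch h) (by decide : ¬(4 : ZMod 5) = 0), hone ?_⟩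
      change ((i - 1 + 1, b), ZigzagKind.inn) = _
      rw [sub_add_cancel]
    · refine ⟨rfl, iff_of_false (fun h => nomatch h) (by decide : ¬(2 : ZMod 5) = 0), hone ?_⟩
      change ((i + 1 - 1, b), ZigzagKind.zig) = _
      rw [add_sub_cancel_right]
    · refine ⟨rfl, iff_of_false (fun h => nomatch h) (by decide : ¬(3 : ZMod 5) = 0), hone ?_⟩
      change ((i + 1 - 1, b), ZigzagKind.zag) = _
      rw [add_sub_cancel_right]
  · refine (ncard_kind (ZMod k × Bool) ZigzagKind.rim).trans ?_
    rw [card_halves, mul_comm]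
  · refine (ncard_kind_compl (ZMod k × Bool) ZigzagKind.rim (r := 5)
      (Nat.card_eq_of_equiv_fin ZigzagKind.equivFin)).trans ?_
    rw [card_halves, one_mul]
  · refine CombMap.IsRegular.card_vertex three_pos hv ?_
    rw [Nat.card_prod, card_halves, Nat.card_eq_of_equiv_fin ZigzagKind.equivFin]
    ring
  · ring

/-! ### Minimal realisations. -/

namespace PaintedMap

variable {D : Type} {P : PaintedMap D} {k m n b w : ℕ}

theorem IsFootballPattern.mul_numBlack_eq_mul_numWhite (h : P.IsFootballPattern k (m * n) n)
    (hl : 0 < m * n) : k * P.numBlack = m * P.numWhite := by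
  have h1 := h.mul_numBlack_eq hl
  rw [mul_comm m, mul_assoc] at h1
  exact Nat.eq_of_mul_eq_mul_left (Nat.pos_of_mul_pos_left hl) h1

/-- A pattern is minimal if the bounds on the numbers of faces follow from the counts. -/
theorem IsMinimalRealisation.of_bounds
    (h : P.IsFootballPattern k (m * n) n ∧ P.numBlack = b ∧ P.numWhite = w) (hl : 0 < m * n)
    (hbw : ∀ B W : ℕ, 0 < B → k * B = m * W → 12 + (n + 1) * (k * B) ≤ 6 * B + 6 * W →
      (n = 1 → 4 + k * B ≤ 2 * B + 2 * W) → (m * n = 4 → n = 4 → 2 ≤ B) → b ≤ B ∧ w ≤ W) :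
    P.IsMinimalRealisation k (m * n) n b w :=
  ⟨h.1, h.2.1, h.2.2, fun _ Q hQ => hbw _ _ hQ.numBlack_pos
    (hQ.mul_numBlack_eq_mul_numWhite hl) (hQ.euler_le hl)
    (by rintro rfl; exact hQ.euler_le_of_one hl)
    (by intro h1 h2; subst h2; rw [h1] at hQ; exact hQ.two_le_numBlack)⟩

end PaintedMap

open PaintedMap IsMinimalRealisation CombMap.IsRegular

theorem tetrahedron_rectify_minimal :
    tetrahedron.rectify.IsMinimalRealisation 3 (3 * 1) 1 4 4 :=
  of_bounds (tetrahedron_isRegular.rectify (by omega) (by omega) rfl rfl rfl) (by norm_num)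
    (by intros; omega)

theorem octahedron_rectify_minimal :
    octahedron.rectify.IsMinimalRealisation 3 (4 * 1) 1 8 6 :=
  of_bounds (octahedron_isRegular.rectify (by omega) (by omega) rfl rfl rfl) (by norm_num)
    (by intros; omega)

theorem cube_rectify_minimal : cube.rectify.IsMinimalRealisation 4 (3 * 1) 1 6 8 :=
  of_bounds (cube_isRegular.rectify (by omega) (by omega) rfl rfl rfl) (by norm_num)
    (by intros; omega)

theorem icosahedron_rectify_minimal :
    icosahedron.rectify.IsMinimalRealisation 3 (5 * 1) 1 20 12 :=
  of_bounds (icosahedron_isRegular.rectify (by omega) (by omega) rfl rfl rfl) (by norm_num)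
    (by intros; omega)

theorem dodecahedron_rectify_minimal :
    dodecahedron.rectify.IsMinimalRealisation 5 (3 * 1) 1 12 20 :=
  of_bounds (dodecahedron_isRegular.rectify (by omega) (by omega) rfl rfl rfl) (by norm_num)
    (by intros; omega)

theorem tetrahedron_truncate_minimal :
    tetrahedron.truncate.IsMinimalRealisation 3 (3 * 2) 2 4 4 :=
  of_bounds (tetrahedron_isRegular.truncate (by omega) (by omega) rfl rfl rfl) (by norm_num)
    (by intros; omega)

theorem cube_truncate_minimal : cube.truncate.IsMinimalRealisation 3 (4 * 2) 2 8 6 :=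
  of_bounds (cube_isRegular.truncate (by omega) (by omega) rfl rfl rfl) (by norm_num)
    (by intros; omega)

theorem octahedron_truncate_minimal :
    octahedron.truncate.IsMinimalRealisation 4 (3 * 2) 2 6 8 :=
  of_bounds (octahedron_isRegular.truncate (by omega) (by omega) rfl rfl rfl) (by norm_num)
    (by intros; omega)

theorem dodecahedron_truncate_minimal :
    dodecahedron.truncate.IsMinimalRealisation 3 (5 * 2) 2 20 12 :=
  of_bounds (dodecahedron_isRegular.truncate (by omega) (by omega) rfl rfl rfl) (by norm_num)
    (by intros; omega)

theorem icosahedron_truncate_minimal :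
    icosahedron.truncate.IsMinimalRealisation 5 (3 * 2) 2 12 20 :=
  of_bounds (icosahedron_isRegular.truncate (by omega) (by omega) rfl rfl rfl) (by norm_num)
    (by intros; omega)

theorem americanFootball_truncate_minimal {k : ℕ} (hk : 3 ≤ k) :
    (americanFootball k).truncate.IsMinimalRealisation k (2 * 2) 2 2 k :=
  of_bounds ((americanFootball_isRegular hk).truncate (by omega) (by omega) (mul_comm _ _) rfl
    (by ring)) (by norm_num) (by
      intro B W _ h1 h2 _ _
      -- Here kB = 2W cancels the terms with k from the Euler inequality and leaves 12 ≤ 6B.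
      have hB : 2 ≤ B := by omega
      have := Nat.mul_le_mul_left k hB
      omega)

theorem tetrahedron_variation_minimal :
    tetrahedron.variation.IsMinimalRealisation 3 (2 * 3) 3 4 6 :=
  of_bounds (tetrahedron_isRegular.variation (by omega) rfl rfl rfl) (by norm_num)
    (by intros; omega)

theorem cube_variation_minimal : cube.variation.IsMinimalRealisation 4 (2 * 3) 3 6 12 :=
  of_bounds (cube_isRegular.variation (by omega) rfl rfl rfl) (by norm_num) (by intros; omega)

theorem dodecahedron_variation_minimal :
    dodecahedron.variation.IsMinimalRealisation 5 (2 * 3) 3 12 30 :=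
  of_bounds (dodecahedron_isRegular.variation (by omega) rfl rfl rfl) (by norm_num)
    (by intros; omega)

theorem partiallyTruncatedAmericanFootball_minimal {k : ℕ} (hk : 3 ≤ k) :
    (partiallyTruncatedAmericanFootball k).IsMinimalRealisation k (1 * 3) 3 1 k :=
  of_bounds (partiallyTruncatedAmericanFootball_pattern hk) (by norm_num) (by
    intro B W hB h1 _ _ _
    have := Nat.mul_le_mul_left k hB
    omega)

theorem doubleTinCan_minimal {k : ℕ} (hk : 3 ≤ k) :
    (doubleTinCan k).IsMinimalRealisation k (1 * 4) 4 2 (2 * k) :=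
  of_bounds (doubleTinCan_pattern hk) (by norm_num) (by
    intro B W _ h1 _ _ h2
    -- The Euler inequality only says 12 ≤ (k + 6)B, which allows B = 1 for k ≥ 6; the weighted
    -- count is needed.
    have hB := h2 rfl rfl
    have := Nat.mul_le_mul_left k hB
    omega)

theorem zigzagTinCan_minimal {k : ℕ} (hk : 3 ≤ k) :
    (zigzagTinCan k).IsMinimalRealisation k (1 * 5) 5 2 (2 * k) :=
  of_bounds (zigzagTinCan_pattern hk) (by norm_num) (by
    intro B W _ h1 h2 _ _
    -- Here kB = W, and the terms with k cancel as well.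
    have hB : 2 ≤ B := by omega
    have := Nat.mul_le_mul_left k hB
    omega)

theorem tetrahedron_subdivision_minimal :
    tetrahedron.subdivision.IsMinimalRealisation 3 (1 * 6) 6 4 12 :=
  of_bounds (tetrahedron_isRegular.subdivision (by omega) rfl rfl) (by norm_num)
    (by intros; omega)

theorem cube_subdivision_minimal : cube.subdivision.IsMinimalRealisation 4 (1 * 6) 6 6 24 :=
  of_bounds (cube_isRegular.subdivision (by omega) rfl rfl) (by norm_num) (by intros; omega)

theorem dodecahedron_subdivision_minimal :
    dodecahedron.subdivision.IsMinimalRealisation 5 (1 * 6) 6 12 60 :=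
  of_bounds (dodecahedron_isRegular.subdivision (by omega) rfl rfl) (by norm_num)
    (by intros; omega)

/-! ### The list of possible triples. -/

/-- The inequality `(n + 1) / 6 < 1 / k + 1 / m` without denominators. -/
theorem lt_of_euler_le {k m n B W : ℕ} (hm : 0 < m) (h1 : k * B = m * W)
    (h2 : 12 + (n + 1) * (k * B) ≤ 6 * B + 6 * W) : (n + 1) * (k * m) < 6 * m + 6 * k := by
  by_contra hc
  push Not at hc
  -- Multiplying the negated claim by B and the Euler inequality by m, and replacing mW by kB,
  -- leaves 12m ≤ 0.
  have h3 := Nat.mul_le_mul_right B hc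
  have h4 := Nat.mul_le_mul_left m h2
  nlinarith

theorem lt_of_euler_le_of_one {k m B W : ℕ} (hm : 0 < m) (h1 : k * B = m * W)
    (h2 : 4 + k * B ≤ 2 * B + 2 * W) : k * m < 2 * m + 2 * k := by
  by_contra hc
  push Not at hc
  have h3 := Nat.mul_le_mul_right B hc
  have h4 := Nat.mul_le_mul_left m h2
  nlinarith

/-- For n ≥ 2 the inequality says ((n+1)m - 6)k < 6m. It bounds k unless (n+1)m ≤ 6, and with l ≥ 3
the exceptions are exactly the infinite sequences. For n = 1 the inequality is (k-2)(m-2) < 4. -/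
theorem classification {k m n : ℕ} (hk : 3 ≤ k) (hm : 0 < m) (hn : 0 < n) (hl : 3 ≤ m * n)
    (h : (n + 1) * (k * m) < 6 * m + 6 * k) (h1 : n = 1 → k * m < 2 * m + 2 * k) :
    (k, m * n, n) ∈ sporadicTriples ∨ (m * n, n) ∈ infiniteSequences := by
  have hn6 : n ≤ 6 := by
    by_contra hc
    push Not at hc
    have h2 : 8 * (k * m) ≤ (n + 1) * (k * m) := Nat.mul_le_mul_right _ (by omega)
    nlinarith
  -- In both cases km < 2m + 2k, that is, (k-2)(m-2) < 4, which is impossible for k ≥ 3 and m ≥ 6.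
  have hm5 : m ≤ 5 := by
    by_contra hc
    push Not at hc
    rcases Nat.lt_or_ge n 2 with h2 | h2
    · have h3 := h1 (by omega)
      nlinarith
    · have h3 : 3 * (k * m) ≤ (n + 1) * (k * m) := Nat.mul_le_mul_right _ (by omega)
      nlinarith
  have key : (m * n, n) ∈ infiniteSequences ∨ k ≤ 5 := by
    interval_cases n <;> interval_cases m <;>
      first | exact Or.inl (by decide) | exact Or.inr (by omega)
  rcases key with h2 | h2
  · exact Or.inr h2
  · interval_cases n <;> interval_cases m <;> interval_cases k <;>
      first | exact Or.inl (by decide) | exact Or.inr (by decide) | omega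

theorem PaintedMap.IsFootballPattern.mem_list {D : Type} {P : PaintedMap D} {k l n : ℕ}
    (hk : 3 ≤ k) (hl : 3 ≤ l) (h : P.IsFootballPattern k l n) :
    (k, l, n) ∈ sporadicTriples ∨ (l, n) ∈ infiniteSequences := by
  obtain ⟨m, rfl⟩ := h.dvd
  rw [mul_comm n m] at h hl ⊢
  have hl0 : 0 < m * n := by omega
  have h1 := h.mul_numBlack_eq_mul_numWhite hl0
  have hm := Nat.pos_of_mul_pos_right hl0
  refine classification hk hm (Nat.pos_of_mul_pos_left hl0) hl
    (lt_of_euler_le hm h1 (h.euler_le hl0)) ?_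
  rintro rfl
  exact lt_of_euler_le_of_one hm h1 (h.euler_le_of_one hl0)

theorem PaintedMap.IsMinimalRealisation.realised {D : Type} {P : PaintedMap D} {k l n b w : ℕ}
    (h : P.IsMinimalRealisation k l n b w) : Realised k l n :=
  ⟨D, P, h.pattern⟩

theorem realised_of_mem_list {k l n : ℕ} (hk : 3 ≤ k)
    (h : (k, l, n) ∈ sporadicTriples ∨ (l, n) ∈ infiniteSequences) : Realised k l n := by
  simp only [sporadicTriples, infiniteSequences, Finset.mem_insert, Finset.mem_singleton,
    Prod.mk.injEq] at h
  rcases h with (⟨rfl, rfl, rfl⟩ | ⟨rfl, rfl, rfl⟩ | ⟨rfl, rfl, rfl⟩ | ⟨rfl, rfl, rfl⟩ |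
    ⟨rfl, rfl, rfl⟩ | ⟨rfl, rfl, rfl⟩ | ⟨rfl, rfl, rfl⟩ | ⟨rfl, rfl, rfl⟩ | ⟨rfl, rfl, rfl⟩ |
    ⟨rfl, rfl, rfl⟩ | ⟨rfl, rfl, rfl⟩ | ⟨rfl, rfl, rfl⟩ | ⟨rfl, rfl, rfl⟩ | ⟨rfl, rfl, rfl⟩ |
    ⟨rfl, rfl, rfl⟩ | ⟨rfl, rfl, rfl⟩) | (⟨rfl, rfl⟩ | ⟨rfl, rfl⟩ | ⟨rfl, rfl⟩ | ⟨rfl, rfl⟩)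
  · exact tetrahedron_rectify_minimal.realised
  · exact octahedron_rectify_minimal.realised
  · exact cube_rectify_minimal.realised
  · exact icosahedron_rectify_minimal.realised
  · exact dodecahedron_rectify_minimal.realised
  · exact tetrahedron_truncate_minimal.realised
  · exact cube_truncate_minimal.realised
  · exact octahedron_truncate_minimal.realised
  · exact dodecahedron_truncate_minimal.realised
  · exact icosahedron_truncate_minimal.realised
  · exact tetrahedron_variation_minimal.realised
  · exact cube_variation_minimal.realised
  · exact dodecahedron_variation_minimal.realised
  · exact tetrahedron_subdivision_minimal.realised
  · exact cube_subdivision_minimal.realised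
  · exact dodecahedron_subdivision_minimal.realised
  · exact (americanFootball_truncate_minimal hk).realised
  · exact (partiallyTruncatedAmericanFootball_minimal hk).realised
  · exact (doubleTinCan_minimal hk).realised
  · exact (zigzagTinCan_minimal hk).realised

/-! ### The theorem. -/

theorem theorem2p6 :
    -- the bounds
    (∀ k l n : ℕ, 3 ≤ k → 3 ≤ l → Realised k l n → l ≤ 10 ∧ n ≤ 6) ∧
    -- the possible triples: sixteen sporadic ones and four infinite sequences
    (∀ k l n : ℕ, 3 ≤ k → 3 ≤ l →
      (Realised k l n ↔ (k, l, n) ∈ sporadicTriples ∨ (l, n) ∈ infiniteSequences)) ∧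
    sporadicTriples.card = 16 ∧ infiniteSequences.card = 4 ∧
    (∀ t ∈ sporadicTriples, t.1 ≤ 5 ∧ t.2 ∉ infiniteSequences) ∧
    -- the minimal realisations, for `(k, l, n)` with `l = m * n`, and their numbers of black and
    -- white faces
    tetrahedron.rectify.IsMinimalRealisation 3 (3 * 1) 1 4 4 ∧
    octahedron.rectify.IsMinimalRealisation 3 (4 * 1) 1 8 6 ∧
    cube.rectify.IsMinimalRealisation 4 (3 * 1) 1 6 8 ∧
    icosahedron.rectify.IsMinimalRealisation 3 (5 * 1) 1 20 12 ∧
    dodecahedron.rectify.IsMinimalRealisation 5 (3 * 1) 1 12 20 ∧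
    tetrahedron.truncate.IsMinimalRealisation 3 (3 * 2) 2 4 4 ∧
    cube.truncate.IsMinimalRealisation 3 (4 * 2) 2 8 6 ∧
    octahedron.truncate.IsMinimalRealisation 4 (3 * 2) 2 6 8 ∧
    dodecahedron.truncate.IsMinimalRealisation 3 (5 * 2) 2 20 12 ∧
    icosahedron.truncate.IsMinimalRealisation 5 (3 * 2) 2 12 20 ∧
    (∀ k : ℕ, 3 ≤ k →
      (americanFootball k).truncate.IsMinimalRealisation k (2 * 2) 2 2 k) ∧
    tetrahedron.variation.IsMinimalRealisation 3 (2 * 3) 3 4 6 ∧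
    cube.variation.IsMinimalRealisation 4 (2 * 3) 3 6 12 ∧
    dodecahedron.variation.IsMinimalRealisation 5 (2 * 3) 3 12 30 ∧
    (∀ k : ℕ, 3 ≤ k →
      (partiallyTruncatedAmericanFootball k).IsMinimalRealisation k (1 * 3) 3 1 k) ∧
    (∀ k : ℕ, 3 ≤ k → (doubleTinCan k).IsMinimalRealisation k (1 * 4) 4 2 (2 * k)) ∧
    (∀ k : ℕ, 3 ≤ k → (zigzagTinCan k).IsMinimalRealisation k (1 * 5) 5 2 (2 * k)) ∧
    tetrahedron.subdivision.IsMinimalRealisation 3 (1 * 6) 6 4 12 ∧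
    cube.subdivision.IsMinimalRealisation 4 (1 * 6) 6 6 24 ∧
    dodecahedron.subdivision.IsMinimalRealisation 5 (1 * 6) 6 12 60 := by
  refine ⟨?_, ?_, by decide, by decide, by decide, tetrahedron_rectify_minimal,
    octahedron_rectify_minimal, cube_rectify_minimal, icosahedron_rectify_minimal,
    dodecahedron_rectify_minimal, tetrahedron_truncate_minimal, cube_truncate_minimal,
    octahedron_truncate_minimal, dodecahedron_truncate_minimal, icosahedron_truncate_minimal,
    fun k => americanFootball_truncate_minimal, tetrahedron_variation_minimal,
    cube_variation_minimal, dodecahedron_variation_minimal,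
    fun k => partiallyTruncatedAmericanFootball_minimal, fun k => doubleTinCan_minimal,
    fun k => zigzagTinCan_minimal, tetrahedron_subdivision_minimal, cube_subdivision_minimal,
    dodecahedron_subdivision_minimal⟩
  · rintro k l n hk hl ⟨D, P, h⟩
    have h1 : ∀ t ∈ sporadicTriples, t.2.1 ≤ 10 ∧ t.2.2 ≤ 6 := by decide
    have h2 : ∀ t ∈ infiniteSequences, t.1 ≤ 10 ∧ t.2 ≤ 6 := by decide
    rcases h.mem_list hk hl with h | h
    · exact h1 _ h
    · exact h2 _ h
  · refine fun k l n hk hl => ⟨?_, realised_of_mem_list hk⟩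
    rintro ⟨D, P, h⟩
    exact h.mem_list hk hl
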